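/- Let $n>2$. Let $G_{8n}$ be the group with generators $\alpha,\beta,\gamma$ and relations $\alpha^{2n}=\beta^2=\gamma^2=(\alpha\beta)^2=1$, $\alpha\gamma=\gamma\alpha$, $\beta\gamma=\gamma\beta$, and, for even $n$, let $H_{8n}$ be the group with the same generators and relations except that the last one is replaced by $\beta\gamma=\gamma\beta\alpha^n$. In either group put $S=\{\alpha^{2i},\ \alpha^{2j+1}\beta,\ \alpha^k\beta\gamma : i,j,k\in\mathbb Z\}$. Acting by right multiplication on the set $L$ of right cosets of $\langle\beta\rangle$, the set $S$ is sharply transitive, so $L$ becomes a loop whose unit $1$ is the coset $\langle\beta\rangle$ and whose left translation $\lambda_x: y\mapsto x y$ is, for each $x\in L$, the action of the unique element of $S$ that maps $1$ to $x$. This loop is called $B_{4n}$ for the group $G_{8n}$ and $C_{4n}$ ($n$ even) for the group $H_{8n}$. Let $L$ be $B_{4n}$, or $C_{4n}$ with $n$ even. Let $\rho_x: y\mapsto yx$ be the right translations, $G(L)=\langle\lambda_x : x\in L\rangle$, and let $N_\lambda=\{m\in L : m(xy)=(mx)y \text{ for all } x,y\in L\}$ be the left nucleus. Regard $\alpha,\gamma$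 as permutations of $L$ (through the action on right cosets); they lie in $G(L)$. Let $\Gamma$ be the group of all direction-preserving collineations of the 3-net of $L$, i.e. of all permutations of $L\times L$ that map each of the three classes of lines $x=c$, $y=c$, $xy=c$ $(c\in L)$ onto itself. For permutations $u,v$ of $L$, let $(u,v)$ denote the permutation of $L\times L$ acting as $u$ on the first and as $v$ on the second coordinate. Let $N=\langle (p_x,\lambda_x) : x\in L\rangle$, where $p_x$ is $\lambda_x^{-1}$ followed by $\rho_x^{-1}$, let $\Phi: N\to G(L)$, $(u,v)\mapsto v$, and put $$T=\{(\lambda_m,\mathrm{id}) : m\in N_\lambda\},\qquad \Lambda=\Phi^{-1}(\langle\alpha,\gamma\rangle),\qquad M=T\Lambda .$$ Then $M$ is an abelian normal subgroup of $\Gamma$, it is isomorphic to $N_\lambda\times\langle\alpha,\gamma\rangle$, and it acts regularly on the orbit of the origin $(1,1)$ under $\Gamma$. Moreover $\Gamma$ is the semidirect product $M\rtimes\mathrm{Aut}(L)$, where $\sigma\in\mathrm{Aut}(L)$ is identified with the collineation $(\sigma,\sigma)$, and the action of $\mathrm{Aut}(L)$ on $M$ is componentwise conjugation, $(u,v)^\sigma=(u^\sigma,v^\sigma)$.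 -/

import Mathlib

open scoped Pointwise

namespace BurnNet

open Equiv (Perm)

/-! ### Loops, their translations and their left nucleus

All permutations are composed as functions, `(f * g) y = f (g y)`. -/

/-- A loop: a set with a multiplication that has a two-sided unit and all of whose left and
right translations are bijective. -/
class Loop (L : Type*) extends MulOneClass L where
  bijective_left : ∀ a : L, Function.Bijective fun y : L => a * y
  bijective_right : ∀ a : L, Function.Bijective fun y : L => y * a

section general

variable (L : Type*) [Loop L]

variable {L} in
/-- The left translation `y ↦ x * y`. -/
noncomputable def leftTrans (x : L) : Perm L :=
  Equiv.ofBijective (fun y => x * y) (Loop.bijective_left x)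

variable {L} in
/-- The right translation `y ↦ y * x`. -/
noncomputable def rightTrans (x : L) : Perm L :=
  Equiv.ofBijective (fun y => y * x) (Loop.bijective_right x)

/-- `G(L)`, the group generated by the left translations. -/
noncomputable def leftMultGroup : Subgroup (Perm L) :=
  Subgroup.closure (Set.range (leftTrans : L → Perm L))

/-- The left nucleus `{m | ∀ x y, m * (x * y) = (m * x) * y}`. -/
def LeftNucleus : Type _ := {m : L // ∀ x y : L, m * (x * y) = (m * x) * y}

variable {L}

theorem exists_nucleus_inv (m : LeftNucleus L) :
    ∃ k : LeftNucleus L, k.1 * m.1 = 1 := by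
  obtain ⟨k, hk⟩ := (Loop.bijective_left m.1).2 1
  have hk : m.1 * k = 1 := hk
  have hinj := (Loop.bijective_left m.1).1
  refine ⟨⟨k, fun x y => hinj ?_⟩, hinj ?_⟩
  · change m.1 * (k * (x * y)) = m.1 * ((k * x) * y)
    rw [m.2, hk, one_mul, m.2, m.2, hk, one_mul]
  · change m.1 * (k * m.1) = m.1 * 1
    rw [m.2, hk, one_mul, mul_one]

/-- The left nucleus is a group under the multiplication of the loop. -/
noncomputable instance : Group (LeftNucleus L) where
  mul a b := ⟨a.1 * b.1, fun x y => by
    rw [← a.2, b.2 x y, a.2, a.2 b.1 x]⟩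
  one := ⟨1, fun x y => by rw [one_mul, one_mul]⟩
  inv m := (exists_nucleus_inv m).choose
  mul_assoc a b c := Subtype.ext (a.2 b.1 c.1).symm
  one_mul a := Subtype.ext (one_mul a.1)
  mul_one a := Subtype.ext (mul_one a.1)
  inv_mul_cancel m := Subtype.ext (exists_nucleus_inv m).choose_spec

/-- The homomorphism `m ↦ (λ_m, id)` on the left nucleus. -/
noncomputable def nucleusHom : LeftNucleus L →* Perm L × Perm L where
  toFun m := (leftTrans m.1, 1)
  map_one' := Prod.ext (Equiv.ext fun y => one_mul y) rfl
  map_mul' a b := Prod.ext (Equiv.ext fun y => (a.2 b.1 y).symm) (one_mul 1).symm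

variable (L)

/-- `T = {(λ_m, id) | m in the left nucleus}`. -/
noncomputable def nucleusGroup : Subgroup (Perm L × Perm L) := (nucleusHom (L := L)).range

/-- The group `N` generated by the pairs `(p_x, λ_x)`, where `p_x` first undoes `λ_x` and then
undoes `ρ_x`. -/
noncomputable def bolGroup : Subgroup (Perm L × Perm L) :=
  Subgroup.closure
    (Set.range fun x : L => ((rightTrans x)⁻¹ * (leftTrans x)⁻¹, leftTrans x))

variable {L} in
theorem snd_mem_of_mem_bolGroup {f : Perm L × Perm L} (hf : f ∈ bolGroup L) :
    f.2 ∈ leftMultGroup L := by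
  have h : bolGroup L ≤ (leftMultGroup L).comap (MonoidHom.snd (Perm L) (Perm L)) := by
    refine (Subgroup.closure_le _).2 ?_
    rintro _ ⟨x, rfl⟩
    exact Subgroup.subset_closure ⟨x, rfl⟩
  exact h hf

/-- The homomorphism `Φ : N → G(L)`, `(u, v) ↦ v`; it maps `(p_x, λ_x)` to `λ_x`. -/
noncomputable def bolHom : bolGroup L →* leftMultGroup L where
  toFun f := ⟨f.1.2, snd_mem_of_mem_bolGroup f.2⟩
  map_one' := rfl
  map_mul' _ _ := rfl

/-- `Φ⁻¹(U)`, viewed as a group of pairs of permutations, for `U` a subgroup of `G(L)`. -/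
noncomputable def bolPreimage (U : Subgroup (Perm L)) : Subgroup (Perm L × Perm L) :=
  ((U.subgroupOf (leftMultGroup L)).comap (bolHom L)).map (bolGroup L).subtype

/-! ### The 3-net of a loop -/

/-- The vertical lines `x = c` of the 3-net with point set `L × L`. -/
def verticalLines : Set (Set (L × L)) := Set.range fun c : L => {P : L × L | P.1 = c}

/-- The horizontal lines `y = c`. -/
def horizontalLines : Set (Set (L × L)) := Set.range fun c : L => {P : L × L | P.2 = c}

/-- The transversal lines `x * y = c`. -/
def transversalLines : Set (Set (L × L)) := Set.range fun c : L => {P : L × L | P.1 * P.2 = c}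

/-- The group of all direction preserving collineations of the 3-net: the permutations of the
point set that map each of the three classes of parallel lines onto itself. -/
def collineationGroup : Subgroup (Perm (L × L)) :=
  MulAction.stabilizer (Perm (L × L)) (verticalLines L) ⊓
    MulAction.stabilizer (Perm (L × L)) (horizontalLines L) ⊓
      MulAction.stabilizer (Perm (L × L)) (transversalLines L)

/-- The pair `(u, v)` acts on the points by `(x, y) ↦ (u x, v y)`. -/
def pairHom (X : Type*) : Perm X × Perm X →* Perm (X × X) where
  toFun f := Equiv.prodCongr f.1 f.2
  map_one' := rfl
  map_mul' _ _ := rfl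

end general

/-! ### The loops `B_{4n}` and `C_{4n}` -/

/-- The names of the loops `B_{4n}`, and `C_{4n}` for even `n`. -/
inductive Family (n : ℕ) : Type
  | B : Family n
  | C : Even n → Family n

/-- The exponent `t` in the relation `β γ = γ β α ^ t`. -/
def Family.twist {n : ℕ} : Family n → ℕ
  | .B => 0
  | .C _ => n

theorem Family.even_twist {n : ℕ} : ∀ F : Family n, Even F.twist
  | .B => Even.zero
  | .C h => h

/-- The three generators. -/
inductive Gen : Type
  | a | b | c

/-- The words that are set to `1`:
`α ^ (2n) = β ^ 2 = γ ^ 2 = (α β) ^ 2 = 1`, `α γ = γ α`, `β γ = γ β α ^ t`,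
with `t = 0` for `B_{4n}` and `t = n` for `C_{4n}`. -/
inductive Family.IsRel {n : ℕ} (F : Family n) : FreeGroup Gen → Prop
  | alpha : F.IsRel (.of .a ^ (2 * n))
  | beta : F.IsRel (.of .b ^ 2)
  | gamma : F.IsRel (.of .c ^ 2)
  | alphaBeta : F.IsRel ((.of .a * .of .b) ^ 2)
  | alphaGamma : F.IsRel ((.of .a * .of .c) * (.of .c * .of .a)⁻¹)
  | betaGamma : F.IsRel ((.of .b * .of .c) * (.of .c * .of .b * .of .a ^ F.twist)⁻¹)

/-- The group `G_{8n}` (for `B_{4n}`), respectively `H_{8n}` (for `C_{4n}`). -/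
abbrev BurnGroup {n : ℕ} (F : Family n) : Type := PresentedGroup {w | F.IsRel w}

section burn

variable {n : ℕ} (F : Family n)

def alpha : BurnGroup F := PresentedGroup.of .a
def beta : BurnGroup F := PresentedGroup.of .b
def gamma : BurnGroup F := PresentedGroup.of .c

/-- The section `{α^{2i}, α^{2j+1} β, α^k β γ}`. As `α ^ (2n) = 1`, letting the exponents run
over all integers is the same as letting `i, j` run over `1, …, n` and `k` over `1, …, 2n`. -/
def sectionSet : Set (BurnGroup F) :=
  {g | (∃ i : ℤ, g = alpha F ^ (2 * i)) ∨ (∃ j : ℤ, g = alpha F ^ (2 * j + 1) * beta F) ∨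
    ∃ k : ℤ, g = alpha F ^ k * beta F * gamma F}

/-- The set of the right cosets `⟨β⟩ g`, which carries the loop. -/
def BurnLoop : Type :=
  Quotient (QuotientGroup.rightRel (Subgroup.zpowers (beta F)))

variable {F} in
/-- The right coset `⟨β⟩ g`. -/
def coset (g : BurnGroup F) : BurnLoop F := Quotient.mk _ g

theorem coset_eq_iff {g h : BurnGroup F} :
    coset g = coset h ↔ h * g⁻¹ ∈ Subgroup.zpowers (beta F) :=
  Quotient.eq.trans QuotientGroup.rightRel_apply

theorem coset_mul_right {g h : BurnGroup F} (e : coset g = coset h) (s : BurnGroup F) :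
    coset (g * s) = coset (h * s) := by
  rw [coset_eq_iff] at e ⊢
  simpa [mul_assoc] using e

variable {F} in
/-- The action of `s` on the right cosets, `⟨β⟩ g ↦ ⟨β⟩ g s`. -/
def act (s : BurnGroup F) : Perm (BurnLoop F) where
  toFun := Quotient.lift (fun g => coset (g * s)) fun _ _ e =>
    coset_mul_right F (Quotient.sound e) s
  invFun := Quotient.lift (fun g => coset (g * s⁻¹)) fun _ _ e =>
    coset_mul_right F (Quotient.sound e) s⁻¹
  left_inv x := by
    induction x using Quotient.inductionOn with
    | h g => change coset (g * s * s⁻¹) = coset g; rw [mul_inv_cancel_right]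
  right_inv x := by
    induction x using Quotient.inductionOn with
    | h g => change coset (g * s⁻¹ * s) = coset g; rw [inv_mul_cancel_right]

@[simp] theorem act_coset (s g : BurnGroup F) : act s (coset g) = coset (g * s) := rfl

theorem generator_relations : beta F * alpha F = (alpha F)⁻¹ * beta F ∧ beta F * beta F = 1 ∧
    gamma F * gamma F = 1 ∧ alpha F * gamma F = gamma F * alpha F ∧
    beta F * gamma F = gamma F * beta F * alpha F ^ F.twist := by
  have hb : beta F ^ 2 = 1 := PresentedGroup.one_of_mem (x := FreeGroup.of Gen.b ^ 2) Family.IsRel.beta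
  have hc : gamma F ^ 2 = 1 := PresentedGroup.one_of_mem (x := FreeGroup.of Gen.c ^ 2) Family.IsRel.gamma
  have hab : (alpha F * beta F) ^ 2 = 1 := PresentedGroup.one_of_mem
    (x := (FreeGroup.of Gen.a * FreeGroup.of Gen.b) ^ 2) Family.IsRel.alphaBeta
  have hac : (alpha F * gamma F) * (gamma F * alpha F)⁻¹ = 1 := PresentedGroup.one_of_mem
    (x := (FreeGroup.of Gen.a * .of .c) * (.of .c * .of .a)⁻¹) Family.IsRel.alphaGamma
  have hbc : (beta F * gamma F) * (gamma F * beta F * alpha F ^ F.twist)⁻¹ = 1 :=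
    PresentedGroup.one_of_mem
      (x := (FreeGroup.of Gen.b * .of .c) * (.of .c * .of .b * .of .a ^ F.twist)⁻¹) Family.IsRel.betaGamma
  have hb' : beta F * beta F = 1 := by rw [← pow_two, hb]
  refine ⟨?_, hb', by rw [← pow_two, hc], mul_inv_eq_one.1 hac, mul_inv_eq_one.1 hbc⟩
  have h1 : alpha F * (beta F * alpha F) * beta F = 1 := by
    rw [← hab, pow_two]; simp only [mul_assoc]
  have h2 : (beta F)⁻¹ = beta F := inv_eq_of_mul_eq_one_left hb'
  rw [mul_eq_one_iff_eq_inv, h2] at h1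
  exact eq_inv_mul_of_mul_eq h1

/-- The exponents of `α`, `β`, `γ` modulo 2. -/
def parity : BurnGroup F →* Multiplicative (ZMod 2 × ZMod 2 × ZMod 2) :=
  PresentedGroup.toGroup (f := fun g : Gen => match g with
    | .a => Multiplicative.ofAdd (1, 0, 0)
    | .b => Multiplicative.ofAdd (0, 1, 0)
    | .c => Multiplicative.ofAdd (0, 0, 1)) (by
    have key : ∀ x : Multiplicative (ZMod 2 × ZMod 2 × ZMod 2), x ^ 2 = 1 := by decide
    intro r hr
    cases hr with
    | alpha => rw [map_pow, pow_mul, key, one_pow]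
    | beta => rw [map_pow, key]
    | gamma => rw [map_pow, key]
    | alphaBeta => rw [map_pow, key]
    | alphaGamma =>
      rw [map_mul, map_inv, map_mul, map_mul, mul_inv_eq_one, mul_comm]
    | betaGamma =>
      obtain ⟨r, hr⟩ := F.even_twist
      rw [map_mul, map_inv, map_mul, map_mul, map_mul, mul_inv_eq_one, map_pow, hr, ← two_mul,
        pow_mul, key, one_pow, mul_one, mul_comm])

@[simp] theorem parity_alpha : parity F (alpha F) = Multiplicative.ofAdd (1, 0, 0) :=
  PresentedGroup.toGroup.of _
@[simp] theorem parity_beta : parity F (beta F) = Multiplicative.ofAdd (0, 1, 0) :=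
  PresentedGroup.toGroup.of _
@[simp] theorem parity_gamma : parity F (gamma F) = Multiplicative.ofAdd (0, 0, 1) :=
  PresentedGroup.toGroup.of _

theorem beta_zpow (k : ℤ) : beta F * alpha F ^ k = alpha F ^ (-k) * beta F := by
  have h : SemiconjBy (beta F) (alpha F) (alpha F)⁻¹ := (generator_relations F).1
  have := h.zpow_right k
  rwa [inv_zpow'] at this

theorem gamma_zpow (k : ℤ) : gamma F * alpha F ^ k = alpha F ^ k * gamma F :=
  ((show Commute (gamma F) (alpha F) from (generator_relations F).2.2.2.1.symm).zpow_right k)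

theorem gamma_beta : gamma F * beta F = alpha F ^ (F.twist : ℤ) * beta F * gamma F := by
  have h := (generator_relations F).2.2.2.2
  rw [← zpow_natCast] at h
  have h2 := beta_zpow F (-(F.twist : ℤ))
  rw [neg_neg] at h2
  rw [← h2, mul_assoc, ← gamma_zpow, ← mul_assoc, h, zpow_neg, mul_inv_cancel_right]

/-- Every element has one of the forms `α^k`, `α^k γ`, `α^k β`, `α^k β γ`. -/
theorem normal_form (g : BurnGroup F) :
    ∃ k : ℤ, g = alpha F ^ k ∨ g = alpha F ^ k * gamma F ∨ g = alpha F ^ k * beta F ∨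
      g = alpha F ^ k * beta F * gamma F := by
  obtain ⟨-, hb, hc, -, -⟩ := generator_relations F
  have hbi : (beta F)⁻¹ = beta F := inv_eq_of_mul_eq_one_left hb
  have hci : (gamma F)⁻¹ = gamma F := inv_eq_of_mul_eq_one_left hc
  have hA : ∀ (e : ℤ) (y : BurnGroup F), (∃ k : ℤ, y = alpha F ^ k ∨ y = alpha F ^ k * gamma F ∨
      y = alpha F ^ k * beta F ∨ y = alpha F ^ k * beta F * gamma F) →
      ∃ k : ℤ, alpha F ^ e * y = alpha F ^ k ∨ alpha F ^ e * y = alpha F ^ k * gamma F ∨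
      alpha F ^ e * y = alpha F ^ k * beta F ∨
      alpha F ^ e * y = alpha F ^ k * beta F * gamma F := by
    rintro e y ⟨k, h⟩
    refine ⟨e + k, ?_⟩
    rcases h with rfl | rfl | rfl | rfl <;> simp [zpow_add, mul_assoc]
  have hB : ∀ (y : BurnGroup F), (∃ k : ℤ, y = alpha F ^ k ∨ y = alpha F ^ k * gamma F ∨
      y = alpha F ^ k * beta F ∨ y = alpha F ^ k * beta F * gamma F) →
      ∃ k : ℤ, beta F * y = alpha F ^ k ∨ beta F * y = alpha F ^ k * gamma F ∨
      beta F * y = alpha F ^ k * beta F ∨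
      beta F * y = alpha F ^ k * beta F * gamma F := by
    rintro y ⟨k, h⟩
    refine ⟨-k, ?_⟩
    rcases h with rfl | rfl | rfl | rfl
    · exact Or.inr (Or.inr (Or.inl (beta_zpow F k)))
    · exact Or.inr (Or.inr (Or.inr (by rw [← mul_assoc, beta_zpow])))
    · exact Or.inl (by rw [← mul_assoc, beta_zpow, mul_assoc, hb, mul_one])
    · exact Or.inr (Or.inl (by
        rw [← mul_assoc, ← mul_assoc, beta_zpow, mul_assoc (alpha F ^ (-k)), hb, mul_one]))
  have hC : ∀ (y : BurnGroup F), (∃ k : ℤ, y = alpha F ^ k ∨ y = alpha F ^ k * gamma F ∨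
      y = alpha F ^ k * beta F ∨ y = alpha F ^ k * beta F * gamma F) →
      ∃ k : ℤ, gamma F * y = alpha F ^ k ∨ gamma F * y = alpha F ^ k * gamma F ∨
      gamma F * y = alpha F ^ k * beta F ∨
      gamma F * y = alpha F ^ k * beta F * gamma F := by
    rintro y ⟨k, h⟩
    rcases h with rfl | rfl | rfl | rfl
    · exact ⟨k, Or.inr (Or.inl (gamma_zpow F k))⟩
    · exact ⟨k, Or.inl (by rw [← mul_assoc, gamma_zpow, mul_assoc, hc, mul_one])⟩
    · exact ⟨k + F.twist, Or.inr (Or.inr (Or.inr (by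
        rw [← mul_assoc, gamma_zpow, mul_assoc, gamma_beta, zpow_add]; simp only [mul_assoc])))⟩
    · exact ⟨k + F.twist, Or.inr (Or.inr (Or.inl (by
        rw [← mul_assoc, ← mul_assoc, gamma_zpow, mul_assoc (alpha F ^ k), gamma_beta, zpow_add]
        simp only [mul_assoc]; rw [hc, mul_one])))⟩
  have hg : g ∈ Subgroup.closure (Set.range (PresentedGroup.of (rels := {w | F.IsRel w}))) := by
    rw [PresentedGroup.closure_range_of]; trivial
  induction hg using Subgroup.closure_induction_left with
  | one => exact ⟨0, Or.inl (zpow_zero _).symm⟩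
  | mul_left x hx y hy ih =>
    obtain ⟨i, rfl⟩ := hx
    cases i with
    | a => simpa [alpha] using hA 1 y ih
    | b => exact hB y ih
    | c => exact hC y ih
  | inv_mul_cancel x hx y hy ih =>
    obtain ⟨i, rfl⟩ := hx
    cases i with
    | a => simpa [alpha] using hA (-1) y ih
    | b => change ∃ k : ℤ, (beta F)⁻¹ * y = _ ∨ (beta F)⁻¹ * y = _ ∨ (beta F)⁻¹ * y = _ ∨
             (beta F)⁻¹ * y = _
           rw [hbi]; exact hB y ih
    | c => change ∃ k : ℤ, (gamma F)⁻¹ * y = _ ∨ (gamma F)⁻¹ * y = _ ∨ (gamma F)⁻¹ * y = _ ∨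
             (gamma F)⁻¹ * y = _
           rw [hci]; exact hC y ih

/-- The parities of the elements of the section. -/
def sectionParities : Finset (Multiplicative (ZMod 2 × ZMod 2 × ZMod 2)) :=
  {Multiplicative.ofAdd (0, 0, 0), Multiplicative.ofAdd (1, 1, 0),
    Multiplicative.ofAdd (0, 1, 1), Multiplicative.ofAdd (1, 1, 1)}

theorem mem_section_iff (g : BurnGroup F) : g ∈ sectionSet F ↔ parity F g ∈ sectionParities := by
  have key : ∀ x : Multiplicative (ZMod 2 × ZMod 2 × ZMod 2), x ^ (2 : ℤ) = 1 := by decide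
  have even : ∀ i : ℤ, parity F (alpha F ^ (2 * i)) = 1 := fun i => by
    rw [map_zpow, zpow_mul, key, one_zpow]
  have odd : ∀ i : ℤ, parity F (alpha F ^ (2 * i + 1)) = Multiplicative.ofAdd (1, 0, 0) :=
    fun i => by rw [zpow_add, map_mul, even, one_mul, zpow_one, parity_alpha]
  constructor
  · rintro (⟨i, rfl⟩ | ⟨i, rfl⟩ | ⟨k, rfl⟩)
    · rw [even]; decide
    · rw [map_mul, odd, parity_beta]; decide
    · obtain ⟨i, rfl | rfl⟩ := Int.even_or_odd' k
      · rw [map_mul, map_mul, even, parity_beta, parity_gamma]; decide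
      · rw [map_mul, map_mul, odd, parity_beta, parity_gamma]; decide
  · intro h
    obtain ⟨k, rfl | rfl | rfl | rfl⟩ := normal_form F g
    · obtain ⟨i, rfl | rfl⟩ := Int.even_or_odd' k
      · exact Or.inl ⟨i, rfl⟩
      · rw [odd] at h; exact absurd h (by decide)
    · obtain ⟨i, rfl | rfl⟩ := Int.even_or_odd' k
      · rw [map_mul, even, parity_gamma] at h; exact absurd h (by decide)
      · rw [map_mul, odd, parity_gamma] at h; exact absurd h (by decide)
    · obtain ⟨i, rfl | rfl⟩ := Int.even_or_odd' k
      · rw [map_mul, even, parity_beta] at h; exact absurd h (by decide)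
      · exact Or.inr (Or.inl ⟨i, rfl⟩)
    · exact Or.inr (Or.inr ⟨k, rfl⟩)

theorem mem_zpowers_beta (g : BurnGroup F) :
    g ∈ Subgroup.zpowers (beta F) ↔ g = 1 ∨ g = beta F := by
  have hb : beta F ^ (2 : ℤ) = 1 := by
    rw [zpow_two]; exact (generator_relations F).2.1
  constructor
  · rintro ⟨k, rfl⟩
    obtain ⟨i, rfl | rfl⟩ := Int.even_or_odd' k
    · left; simp [zpow_mul, hb]
    · right; simp [zpow_add, zpow_mul, hb]
  · rintro (rfl | rfl)
    · exact one_mem _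
    · exact Subgroup.mem_zpowers _

/-- For all `a` and `g` there is exactly one `s` in the section with `⟨β⟩ a s = ⟨β⟩ g`: the
section is a sharply transitive set of permutations of the right cosets. -/
theorem section_sharp (a g : BurnGroup F) :
    ∃! s, s ∈ sectionSet F ∧ coset (a * s) = coset g := by
  have hb := (generator_relations F).2.1
  have hbi : (beta F)⁻¹ = beta F := inv_eq_of_mul_eq_one_left hb
  have form : ∀ s, coset (a * s) = coset g ↔ s = a⁻¹ * g ∨ s = a⁻¹ * (beta F * g) := by
    intro s
    rw [coset_eq_iff, mem_zpowers_beta, mul_inv_eq_one, mul_inv_eq_iff_eq_mul, eq_inv_mul_iff_mul_eq,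
      eq_inv_mul_iff_mul_eq]
    refine or_congr eq_comm ⟨fun h => ?_, fun h => ?_⟩
    · rw [h, ← mul_assoc, hb, one_mul]
    · rw [h, ← mul_assoc, hb, one_mul]
  have dich : ∀ x : Multiplicative (ZMod 2 × ZMod 2 × ZMod 2),
      ¬ (x ∈ sectionParities ↔ Multiplicative.ofAdd (0, 1, 0) * x ∈ sectionParities) := by
    decide
  have hp : parity F (a⁻¹ * (beta F * g)) =
      Multiplicative.ofAdd (0, 1, 0) * parity F (a⁻¹ * g) := by
    rw [map_mul, map_mul, map_mul, parity_beta, mul_left_comm]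
  have hd := dich (parity F (a⁻¹ * g))
  rw [← hp, ← mem_section_iff, ← mem_section_iff] at hd
  by_cases h : a⁻¹ * g ∈ sectionSet F
  · refine ⟨_, ⟨h, (form _).2 (Or.inl rfl)⟩, ?_⟩
    rintro s ⟨hs, hs'⟩
    rcases (form s).1 hs' with rfl | rfl
    · rfl
    · exact absurd ⟨fun _ => hs, fun _ => h⟩ hd
  · have h' : a⁻¹ * (beta F * g) ∈ sectionSet F := by
      by_contra h'
      exact hd ⟨fun x => absurd x h, fun x => absurd x h'⟩
    refine ⟨_, ⟨h', (form _).2 (Or.inr rfl)⟩, ?_⟩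
    rintro s ⟨hs, hs'⟩
    rcases (form s).1 hs' with rfl | rfl
    · exact absurd hs h
    · rfl

theorem exists_section (x : BurnLoop F) : ∃! s, s ∈ sectionSet F ∧ coset s = x := by
  induction x using Quotient.inductionOn with
  | h g =>
    have h := section_sharp F 1 g
    simp only [one_mul] at h
    exact h

variable {F} in
/-- The element of the section that maps the unit coset `⟨β⟩` to the coset `x`. -/
noncomputable def rep (x : BurnLoop F) : BurnGroup F := (exists_section F x).choose

theorem rep_mem (x : BurnLoop F) : rep x ∈ sectionSet F := (exists_section F x).choose_spec.1.1

@[simp] theorem coset_rep (x : BurnLoop F) : coset (rep x) = x :=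
  (exists_section F x).choose_spec.1.2

theorem rep_eq {x : BurnLoop F} {s : BurnGroup F} (hs : s ∈ sectionSet F) (h : coset s = x) :
    rep x = s :=
  (exists_section F x).unique ⟨rep_mem F x, coset_rep F x⟩ ⟨hs, h⟩

/-- The loop `B_{4n}`, respectively `C_{4n}`: its unit is the coset `⟨β⟩`, and its left translation
by `x` is the action of the element of the section that maps the unit to `x`. -/
noncomputable instance : Loop (BurnLoop F) where
  one := coset 1
  mul x y := act (rep x) y
  one_mul x := by
    change act (rep (coset 1)) x = x
    rw [rep_eq F (s := 1) (Or.inl ⟨0, by simp⟩) rfl]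
    induction x using Quotient.inductionOn with
    | h g => change coset (g * 1) = coset g; rw [mul_one]
  mul_one x := by
    change act (rep x) (coset 1) = x
    rw [act_coset, one_mul, coset_rep]
  bijective_left x := (act (rep x)).bijective
  bijective_right y := by
    change Function.Bijective fun x : BurnLoop F => act (rep x) y
    induction y using Quotient.inductionOn with
    | h a =>
      change Function.Bijective fun x : BurnLoop F => coset (a * rep x)
      constructor
      · intro x x' h
        have h : coset (a * rep x) = coset (a * rep x') := h
        have := (section_sharp F a (a * rep x')).unique ⟨rep_mem F x, h⟩ ⟨rep_mem F x', rfl⟩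
        rw [← coset_rep F x, this, coset_rep]
      · intro z
        induction z using Quotient.inductionOn with
        | h g =>
          obtain ⟨s, ⟨hs, h⟩, -⟩ := section_sharp F a g
          refine ⟨coset s, ?_⟩
          change coset (a * rep (coset s)) = coset g
          rw [rep_eq F hs rfl, h]

/-- `Λ₀ = ⟨α, γ⟩`, as a group of permutations of the loop. -/
def lambdaZero : Subgroup (Perm (BurnLoop F)) :=
  Subgroup.closure {act (alpha F), act (gamma F)}

/-- `Λ = Φ⁻¹(Λ₀)`. -/
noncomputable def lambdaGroup : Subgroup (Perm (BurnLoop F) × Perm (BurnLoop F)) :=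
  bolPreimage (BurnLoop F) (lambdaZero F)

/-- The group of pairs of permutations generated by `T` and `Λ`. -/
noncomputable def mPairs : Subgroup (Perm (BurnLoop F) × Perm (BurnLoop F)) :=
  nucleusGroup (BurnLoop F) ⊔ lambdaGroup F

/-- The group `M = TΛ`, acting on the points of the 3-net. -/
noncomputable def mGroup : Subgroup (Perm (BurnLoop F × BurnLoop F)) :=
  (mPairs F).map (pairHom (BurnLoop F))

end burn

end BurnNet

open BurnNet

namespace BurnNet

open Equiv (Perm)

/-! ### Collineations and autotopisms -/

section fibers

variable {X L : Type*} {π : X → L}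

/-! A direction preserving collineation is a pair `(u, v)` that extends to an autotopism `(u, v, w)`
(`collineationGroup_eq_map`). Comparing the autotopism equation at `x` and at the unit gives `v λ_x
v⁻¹ = λ_{u 1}⁻¹ λ_{u x}` (`conj_leftTrans`).

For the loops at hand, membership in the section `S` depends only on the parities of the exponents,
that is, on the image in an elementary abelian group of order 8 (`mem_section_iff`). Hence `S` is
closed under `t ↦ s t s`, which is the left Bol identity and makes `N` a group of autotopisms. It is
also closed under conjugation, and the `h` with `S h ⊆ S` are those of trivial parity. They form
`⟨α²⟩`, which yields the left nucleus.

The crux is `parity_rep_fst_one`: `u` sends the unit into the left nucleus. Let `a` be the section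
element of `u 1`. If `g a ∈ S`, then `g` acts as a `v`-conjugate of a section element, so `g ^ n =
1` or `g ^ 4 = 1`. For `n > 2` neither holds for `α` or `αγ`, so `αa` and `αγa` lie outside `S`, and
only trivial parity is left for `a`. Therefore `v` normalizes `S`, hence `⟨α²⟩`, hence the
centralizer of `⟨α²⟩` in `G(L)`, which is `⟨α, γ⟩` (`conj_mem_lambdaZero`).

As the autotopisms with `v = 1` form `T`, the group `M` consists of all autotopisms with `v ∈ ⟨α,
γ⟩` (`mem_mPairs`), so it is normal. Since `⟨α, γ⟩` is regular on the loop and `T` corrects the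
first coordinate, `M` is regular on the orbit of the origin; the stabilizer of the origin, `Aut(L)`,
is a complement. Finally `v ↦ (c_v, v)` with `λ_{c_v x} = v λ_x v⁻¹` splits `M` over `⟨α, γ⟩`, and
it commutes with `T` because the `λ_m` lie in the abelian group `⟨α, γ⟩`. -/

theorem exists_map_of_smul_fibers {f : Perm X}
    (hf : f • (Set.range fun c : L => {P : X | π P = c}) = Set.range fun c : L => {P | π P = c}) :
    ∃ w : L → L, ∀ P, π (f P) = w (π P) := by
  have h : ∀ c : L, ∃ d : L, f • {P : X | π P = c} = {P : X | π P = d} := fun c => by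
    have hc : f • {P : X | π P = c} ∈ f • Set.range fun c : L => {P : X | π P = c} :=
      Set.smul_mem_smul_set ⟨c, rfl⟩
    rw [hf] at hc
    obtain ⟨d, hd⟩ := hc
    exact ⟨d, hd.symm⟩
  choose w hw using h
  refine ⟨w, fun P => ?_⟩
  have hP : f • P ∈ f • {Q : X | π Q = π P} := Set.smul_mem_smul_set rfl
  rw [hw] at hP
  exact hP

/-- A permutation permutes the fibres of a surjection if and only if it descends to a
permutation of the target. -/
theorem mem_stabilizer_fibers_iff (hπ : Function.Surjective π) (f : Perm X) :
    f ∈ MulAction.stabilizer (Perm X) (Set.range fun c : L => {P : X | π P = c}) ↔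
      ∃ w : Perm L, ∀ P, π (f P) = w (π P) := by
  constructor
  · intro hf
    obtain ⟨w, hw⟩ := exists_map_of_smul_fibers (MulAction.mem_stabilizer_iff.1 hf)
    -- The map induced by `f⁻¹` is the inverse of the map induced by `f`.
    obtain ⟨w', hw'⟩ := exists_map_of_smul_fibers (MulAction.mem_stabilizer_iff.1 (inv_mem hf))
    refine ⟨⟨w, w', fun c => ?_, fun c => ?_⟩, hw⟩
    · obtain ⟨P, rfl⟩ := hπ c
      rw [← hw, ← hw', ← Perm.mul_apply, inv_mul_cancel, Perm.one_apply]
    · obtain ⟨P, rfl⟩ := hπ c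
      rw [← hw', ← hw, ← Perm.mul_apply, mul_inv_cancel, Perm.one_apply]
  · rintro ⟨w, hw⟩
    have key : ∀ c, f • {P : X | π P = c} = {P : X | π P = w c} := fun c => by
      ext P
      rw [Set.mem_smul_set_iff_inv_smul_mem]
      change π (f⁻¹ P) = c ↔ π P = w c
      rw [← w.injective.eq_iff, ← hw, ← Perm.mul_apply, mul_inv_cancel, Perm.one_apply]
    rw [MulAction.mem_stabilizer_iff]
    ext S
    constructor
    · rintro ⟨_, ⟨c, rfl⟩, rfl⟩
      exact ⟨w c, (key c).symm⟩
    · rintro ⟨c, rfl⟩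
      refine ⟨_, ⟨w.symm c, rfl⟩, ?_⟩
      change f • {P : X | π P = w.symm c} = _
      rw [key, Equiv.apply_symm_apply]

end fibers

/-! ### Autotopisms of an arbitrary loop -/

section autotopism

variable (L : Type*) [Loop L]

/-- The pairs `(u, v)` that extend to an autotopism `(u, v, w)` of the loop. -/
def autotopismPairs : Subgroup (Perm L × Perm L) where
  carrier := {f | ∃ w : Perm L, ∀ x y, f.1 x * f.2 y = w (x * y)}
  mul_mem' := by
    rintro f g ⟨w, hw⟩ ⟨w', hw'⟩
    refine ⟨w * w', fun x y => ?_⟩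
    change f.1 (g.1 x) * f.2 (g.2 y) = w (w' (x * y))
    rw [hw, hw']
  one_mem' := ⟨1, fun _ _ => rfl⟩
  inv_mem' := by
    rintro f ⟨w, hw⟩
    refine ⟨w⁻¹, fun x y => ?_⟩
    rw [Perm.eq_inv_iff_eq, ← hw]
    simp

variable {L}

theorem pairHom_injective : Function.Injective (pairHom L) := by
  intro f g h
  have h' : ∀ x y : L, (f.1 x, f.2 y) = (g.1 x, g.2 y) := fun x y => DFunLike.congr_fun h (x, y)
  exact Prod.ext (Equiv.ext fun x => congrArg Prod.fst (h' x 1))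
    (Equiv.ext fun y => congrArg Prod.snd (h' 1 y))

/-- The direction preserving collineations are the autotopisms. -/
theorem collineationGroup_eq_map :
    collineationGroup L = (autotopismPairs L).map (pairHom L) := by
  have h1 : Function.Surjective (Prod.fst : L × L → L) := fun x => ⟨(x, 1), rfl⟩
  have h2 : Function.Surjective (Prod.snd : L × L → L) := fun x => ⟨(1, x), rfl⟩
  have h3 : Function.Surjective (fun P : L × L => P.1 * P.2) := fun x => ⟨(x, 1), mul_one x⟩
  ext f
  refine (and_congr (and_congr (mem_stabilizer_fibers_iff h1 f) (mem_stabilizer_fibers_iff h2 f))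
    (mem_stabilizer_fibers_iff h3 f)).trans ?_
  constructor
  · rintro ⟨⟨⟨u, hu⟩, v, hv⟩, w, hw⟩
    refine ⟨(u, v), ⟨w, fun x y => ?_⟩, Equiv.ext fun P => Prod.ext (hu P).symm (hv P).symm⟩
    have := hw (x, y)
    rwa [hu, hv] at this
  · rintro ⟨⟨u, v⟩, ⟨w, hw⟩, rfl⟩
    exact ⟨⟨⟨u, fun _ => rfl⟩, v, fun _ => rfl⟩, w, fun P => hw P.1 P.2⟩

theorem leftTrans_injective : Function.Injective (leftTrans : L → Perm L) := fun x y h => by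
  rw [← mul_one x, ← mul_one y]
  exact DFunLike.congr_fun h 1

/-- The conjugate of a left translation by the second component of an autotopism. -/
theorem conj_leftTrans {f : Perm L × Perm L} (hf : f ∈ autotopismPairs L) (x : L) :
    f.2 * leftTrans x * f.2⁻¹ = (leftTrans (f.1 1))⁻¹ * leftTrans (f.1 x) := by
  obtain ⟨w, hw⟩ := hf
  rw [eq_inv_mul_iff_mul_eq, ← mul_assoc, mul_inv_eq_iff_eq_mul]
  ext y
  change f.1 1 * f.2 (x * y) = f.1 x * f.2 y
  rw [hw, hw, one_mul]

theorem conj_mem_leftMultGroup {f : Perm L × Perm L} (hf : f ∈ autotopismPairs L) {z : Perm L}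
    (hz : z ∈ leftMultGroup L) : f.2 * z * f.2⁻¹ ∈ leftMultGroup L := by
  have h : leftMultGroup L ≤ (leftMultGroup L).comap (MulAut.conj f.2).toMonoidHom := by
    refine (Subgroup.closure_le _).2 ?_
    rintro _ ⟨x, rfl⟩
    change f.2 * leftTrans x * f.2⁻¹ ∈ leftMultGroup L
    rw [conj_leftTrans hf]
    exact mul_mem (inv_mem (Subgroup.subset_closure ⟨_, rfl⟩)) (Subgroup.subset_closure ⟨_, rfl⟩)
  exact h hz

theorem nucleusGroup_le_autotopismPairs : nucleusGroup L ≤ autotopismPairs L := by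
  rintro _ ⟨m, rfl⟩
  exact ⟨leftTrans m.1, fun x y => (m.2 x y).symm⟩

/-- The autotopisms with trivial second component form the group `T`. -/
theorem mem_nucleusGroup_of_snd_eq_one {f : Perm L × Perm L} (hf : f ∈ autotopismPairs L)
    (h : f.2 = 1) : f ∈ nucleusGroup L := by
  obtain ⟨w, hw⟩ := hf
  rw [h] at hw
  have hw : ∀ x y, f.1 x * y = w (x * y) := hw
  -- Putting `y = 1` identifies the first and third components; putting `x = 1` then shows that both
  -- are the left translation by the image of the unit.
  have h1 : ∀ x, f.1 x = w x := fun x => by rw [← mul_one (f.1 x), hw, mul_one]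
  have h2 : ∀ y, f.1 1 * y = f.1 y := fun y => by rw [hw, one_mul, h1]
  refine ⟨⟨f.1 1, fun x y => ?_⟩, Prod.ext (Equiv.ext h2) h.symm⟩
  rw [h2, h2, hw, h1]

theorem mem_bolPreimage {U : Subgroup (Perm L)} {f : Perm L × Perm L} :
    f ∈ bolPreimage L U ↔ f ∈ bolGroup L ∧ f.2 ∈ U := by
  constructor
  · rintro ⟨⟨g, hg⟩, hgU, rfl⟩
    exact ⟨hg, hgU⟩
  · rintro ⟨hf, hU⟩
    exact ⟨⟨f, hf⟩, hU, rfl⟩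

/-- Surjectivity of `Φ`: every generator `λ_x` of `G(L)` is hit. This is what lifts elements of `⟨α,
γ⟩` to collineations. -/
theorem exists_mem_bolGroup {v : Perm L} (hv : v ∈ leftMultGroup L) : ∃ u, (u, v) ∈ bolGroup L := by
  have h : leftMultGroup L ≤ (bolGroup L).map (MonoidHom.snd (Perm L) (Perm L)) := by
    refine (Subgroup.closure_le _).2 ?_
    rintro _ ⟨x, rfl⟩
    exact ⟨_, Subgroup.subset_closure ⟨x, rfl⟩, rfl⟩
  obtain ⟨⟨u, _⟩, hf, rfl⟩ := h hv
  exact ⟨u, hf⟩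

/-- In a left Bol loop the group `N` consists of autotopisms. -/
theorem bolGroup_le_autotopismPairs (bol : ∀ x y z : L, x * (y * (x * z)) = (x * (y * x)) * z) :
    bolGroup L ≤ autotopismPairs L := by
  refine (Subgroup.closure_le _).2 ?_
  rintro _ ⟨x, rfl⟩
  refine ⟨(leftTrans x)⁻¹, fun y z => ?_⟩
  change ((rightTrans x)⁻¹ * (leftTrans x)⁻¹) y * (x * z) = (leftTrans x)⁻¹ (y * z)
  rw [Perm.eq_inv_iff_eq, ← mul_inv_rev]
  -- Writing the argument as `x * (y * x)` cancels `p_x` and leaves exactly the Bol identity.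
  obtain ⟨y, rfl⟩ := (leftTrans x * rightTrans x).surjective y
  rw [← Perm.mul_apply, inv_mul_cancel]
  exact bol x y z

/-- An autotopism that fixes the origin is an automorphism. -/
theorem exists_mulAut_of_fixes_one {f : Perm L × Perm L} (hf : f ∈ autotopismPairs L)
    (h1 : f.1 1 = 1) (h2 : f.2 1 = 1) :
    ∃ σ : MulAut L, f = (MulAut.toPerm L σ, MulAut.toPerm L σ) := by
  obtain ⟨w, hw⟩ := hf
  have hu : ∀ x, f.1 x = w x := fun x => by rw [← mul_one (f.1 x), ← h2, hw, mul_one]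
  have hv : ∀ x, f.2 x = w x := fun x => by rw [← one_mul (f.2 x), ← h1, hw, one_mul]
  exact ⟨⟨w, fun x y => by change w _ = w _ * w _; rw [← hw, hu, hv]⟩,
    Prod.ext (Equiv.ext hu) (Equiv.ext hv)⟩

variable (L) in
/-- The automorphism `σ` acts on the points as `(σ, σ)`. -/
def diagonalHom : MulAut L →* Perm (L × L) :=
  (pairHom L).comp ((MulAut.toPerm L).prod (MulAut.toPerm L))

theorem diagonalHom_mem (σ : MulAut L) : diagonalHom L σ ∈ collineationGroup L := by
  rw [collineationGroup_eq_map]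
  exact ⟨_, ⟨MulAut.toPerm L σ, fun x y => (map_mul σ x y).symm⟩, rfl⟩

/-! ### Normal subgroups that are regular on the orbit of the origin -/

section regular

variable {M : Subgroup (Perm L × Perm L)}
  (hM : M ≤ autotopismPairs L)
  (hnormal : ∀ f ∈ autotopismPairs L, ∀ m ∈ M, f * m * f⁻¹ ∈ M)
  (htrans : ∀ f ∈ autotopismPairs L, ∃ m ∈ M, m.1 1 = f.1 1 ∧ m.2 1 = f.2 1)
  (hfree : ∀ m ∈ M, m.1 1 = 1 → m.2 1 = 1 → m = 1)

include hM in
theorem map_pairHom_le_collineationGroup : M.map (pairHom L) ≤ collineationGroup L := by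
  rw [collineationGroup_eq_map]
  exact Subgroup.map_mono hM

include hnormal in
theorem conj_mem_map_pairHom {f m : Perm (L × L)} (hf : f ∈ collineationGroup L)
    (hm : m ∈ M.map (pairHom L)) : f * m * f⁻¹ ∈ M.map (pairHom L) := by
  rw [collineationGroup_eq_map] at hf
  obtain ⟨f, hf, rfl⟩ := hf
  obtain ⟨m, hm, rfl⟩ := hm
  exact ⟨_, hnormal f hf m hm, by simp⟩

include htrans in
theorem exists_map_pairHom_apply_origin {f : Perm (L × L)} (hf : f ∈ collineationGroup L) :
    ∃ m ∈ M.map (pairHom L), m (1, 1) = f (1, 1) := by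
  rw [collineationGroup_eq_map] at hf
  obtain ⟨f, hf, rfl⟩ := hf
  obtain ⟨m, hm, h1, h2⟩ := htrans f hf
  exact ⟨_, ⟨m, hm, rfl⟩, Prod.ext h1 h2⟩

include hfree in
theorem eq_one_of_fixes_origin {m : Perm (L × L)} (hm : m ∈ M.map (pairHom L))
    (h : m (1, 1) = (1, 1)) : m = 1 := by
  obtain ⟨m, hm, rfl⟩ := hm
  rw [hfree m hm (congrArg Prod.fst h) (congrArg Prod.snd h), map_one]

include htrans hfree in
theorem regular_on_orbit {P Q : L × L}
    (hP : P ∈ MulAction.orbit (collineationGroup L) ((1, 1) : L × L))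
    (hQ : Q ∈ MulAction.orbit (collineationGroup L) ((1, 1) : L × L)) :
    ∃! f : M.map (pairHom L), f • P = Q := by
  obtain ⟨p, rfl⟩ := hP
  obtain ⟨q, rfl⟩ := hQ
  -- Both points are images of the origin under elements `a`, `b` of the subgroup, so `b a⁻¹` is the
  -- only candidate.
  obtain ⟨a, ha, ha1⟩ := exists_map_pairHom_apply_origin htrans p.2
  obtain ⟨b, hb, hb1⟩ := exists_map_pairHom_apply_origin htrans q.2
  change ∃! f : M.map (pairHom L), f.1 (p.1 (1, 1)) = q.1 (1, 1)
  rw [← ha1, ← hb1]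
  refine ⟨⟨b * a⁻¹, mul_mem hb (inv_mem ha)⟩, by simp, fun f hf => Subtype.ext ?_⟩
  have : b⁻¹ * f.1 * a = 1 :=
    eq_one_of_fixes_origin hfree (mul_mem (mul_mem (inv_mem hb) f.2) ha) (by simp [hf])
  rwa [mul_eq_one_iff_eq_inv, inv_mul_eq_iff_eq_mul] at this

include hM hnormal htrans hfree in
/-- A normal subgroup of the collineation group that is regular on the orbit of the origin is
complemented by the automorphism group of the loop. -/
theorem exists_semidirectProduct :
    ∃ φ : MulAut L →* MulAut (M.map (pairHom L)),
      (∀ (σ : MulAut L) (u v : Perm L) (h : pairHom L (u, v) ∈ M.map (pairHom L)),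
        (φ σ ⟨pairHom L (u, v), h⟩ : Perm (L × L)) =
          pairHom L (MulAut.toPerm _ σ * u * (MulAut.toPerm _ σ)⁻¹,
              MulAut.toPerm _ σ * v * (MulAut.toPerm _ σ)⁻¹)) ∧
      ∃ e : (M.map (pairHom L) ⋊[φ] MulAut L) ≃* collineationGroup L,
        (∀ f : M.map (pairHom L), (e (SemidirectProduct.inl f) : Perm (L × L)) = f) ∧
        (∀ σ : MulAut L, (e (SemidirectProduct.inr σ) : Perm (L × L)) =
            pairHom L (MulAut.toPerm _ σ, MulAut.toPerm _ σ)) := by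
  have hle := map_pairHom_le_collineationGroup hM
  have hnorm : ∀ σ : MulAut L,
      diagonalHom L σ ∈ Subgroup.normalizer (M.map (pairHom L) : Set (Perm (L × L))) := by
    intro σ
    rw [Subgroup.mem_normalizer_iff]
    refine fun m => ⟨conj_mem_map_pairHom hnormal (diagonalHom_mem σ), fun hm => ?_⟩
    have := conj_mem_map_pairHom hnormal (inv_mem (diagonalHom_mem σ)) hm
    simpa [mul_assoc] using this
  let φ : MulAut L →* MulAut (M.map (pairHom L)) :=
    (M.map (pairHom L)).normalizerMonoidHom.comp ((diagonalHom L).codRestrict _ hnorm)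
  have hφ : ∀ σ m, (φ σ m : Perm (L × L)) = diagonalHom L σ * m.1 * (diagonalHom L σ)⁻¹ :=
    fun _ _ => rfl
  let e : (M.map (pairHom L) ⋊[φ] MulAut L) →* collineationGroup L :=
    SemidirectProduct.lift (Subgroup.inclusion hle)
      ((diagonalHom L).codRestrict _ diagonalHom_mem)
      fun σ => MonoidHom.ext fun m => Subtype.ext (hφ σ m)
  have he : ∀ a, (e a : Perm (L × L)) = a.left.1 * diagonalHom L a.right := fun _ => rfl
  have hfix : ∀ σ : MulAut L, diagonalHom L σ (1, 1) = (1, 1) := fun σ =>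
    Prod.ext (map_one σ) (map_one σ)
  have hbij : Function.Bijective e := by
    constructor
    · rw [injective_iff_map_eq_one]
      intro a ha
      have ha : a.left.1 * diagonalHom L a.right = 1 := by rw [← he, ha]; rfl
      have hl : a.left.1 = 1 := by
        -- Automorphisms fix the origin, so evaluating the product there isolates its factor in the
        -- normal subgroup.
        refine eq_one_of_fixes_origin hfree a.left.2 ?_
        have := DFunLike.congr_fun ha (1, 1)
        rwa [Perm.mul_apply, hfix] at this
      rw [hl, one_mul] at ha
      refine SemidirectProduct.ext (Subtype.ext hl) (MulEquiv.ext fun x => ?_)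
      exact congrArg Prod.fst (DFunLike.congr_fun ha (x, x))
    · rintro ⟨f, hf⟩
      -- A Frattini argument: `m⁻¹ f` fixes the origin and is therefore an automorphism.
      obtain ⟨m, hm, hm1⟩ := exists_map_pairHom_apply_origin htrans hf
      have hmem : m⁻¹ * f ∈ collineationGroup L := mul_mem (inv_mem (hle hm)) hf
      have h1 : (m⁻¹ * f) (1, 1) = (1, 1) := by simp [← hm1]
      rw [collineationGroup_eq_map] at hmem
      obtain ⟨g, hg, hgf⟩ := hmem
      rw [← hgf] at h1
      obtain ⟨σ, hσ⟩ := exists_mulAut_of_fixes_one hg (congrArg Prod.fst h1) (congrArg Prod.snd h1)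
      refine ⟨⟨⟨m, hm⟩, σ⟩, Subtype.ext ?_⟩
      change m * diagonalHom L σ = f
      rw [← eq_inv_mul_iff_mul_eq, ← hgf, hσ]
      rfl
  refine ⟨φ, fun σ u v h => ?_, MulEquiv.ofBijective e hbij, fun f => ?_, fun σ => ?_⟩
  · rw [hφ]
    rfl
  · change (e (SemidirectProduct.inl f) : Perm (L × L)) = f
    rw [he]; simp
  · change (e (SemidirectProduct.inr σ) : Perm (L × L)) = _
    rw [he]; simp [diagonalHom]

end regular

end autotopism

end BurnNet

namespace BurnNet

open Equiv (Perm)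

section burn

variable {n : ℕ} (F : Family n)

/-! ### The order of `α` and the faithfulness of the action -/

theorem Family.two_mul_twist : (F.twist : ZMod (2 * n)) + F.twist = 0 := by
  cases F with
  | B => simp [Family.twist]
  | C h =>
    change ((n : ℕ) : ZMod (2 * n)) + (n : ℕ) = 0
    rw [← Nat.cast_add, ← two_mul, ZMod.natCast_self]

/-- The shift `(j, k) ↦ (j, k + 1)`. -/
def modelAlpha (n : ℕ) : Perm (Bool × ZMod (2 * n)) where
  toFun x := (x.1, x.2 + 1)
  invFun x := (x.1, x.2 - 1)
  left_inv x := by simp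
  right_inv x := by simp

/-- The twisted reflection `(j, k) ↦ (j, j t - k)`. -/
def modelBeta : Perm (Bool × ZMod (2 * n)) :=
  Function.Involutive.toPerm (fun x => (x.1, (if x.1 then (F.twist : ZMod (2 * n)) else 0) - x.2))
    fun x => by simp

/-- The swap `(j, k) ↦ (1 - j, k)`. -/
def modelGamma (n : ℕ) : Perm (Bool × ZMod (2 * n)) :=
  Function.Involutive.toPerm (fun x => (!x.1, x.2)) fun x => by simp

@[simp] theorem modelAlpha_apply (x : Bool × ZMod (2 * n)) :
    modelAlpha n x = (x.1, x.2 + 1) := rfl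

@[simp] theorem modelBeta_apply (x : Bool × ZMod (2 * n)) :
    modelBeta F x = (x.1, (if x.1 then (F.twist : ZMod (2 * n)) else 0) - x.2) := rfl

@[simp] theorem modelGamma_apply (x : Bool × ZMod (2 * n)) :
    modelGamma n x = (!x.1, x.2) := rfl

theorem modelAlpha_pow_apply (k : ℕ) (x : Bool × ZMod (2 * n)) :
    (modelAlpha n ^ k) x = (x.1, x.2 + k) := by
  induction k with
  | zero => simp
  | succ k ih => rw [pow_succ', Perm.mul_apply, ih]; simp [add_assoc]

/-- The action of the group on a concrete set of `4n` points. -/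
def model : BurnGroup F →* Perm (Bool × ZMod (2 * n)) :=
  PresentedGroup.toGroup (f := fun g : Gen => match g with
    | .a => modelAlpha n
    | .b => modelBeta F
    | .c => modelGamma n) (by
    intro r hr
    have ht := F.two_mul_twist
    cases hr with
    | alpha =>
      rw [map_pow, FreeGroup.lift_apply_of]
      ext1 x
      rw [modelAlpha_pow_apply, ZMod.natCast_self, add_zero]
      rfl
    | beta => rw [map_pow, FreeGroup.lift_apply_of, pow_two]; ext1 x; simp
    | gamma => rw [map_pow, FreeGroup.lift_apply_of, pow_two]; ext1 x; simp
    | alphaBeta =>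
      rw [map_pow, map_mul, FreeGroup.lift_apply_of, FreeGroup.lift_apply_of, pow_two]
      ext1 x
      refine Prod.ext rfl ?_
      simp
      ring
    | alphaGamma =>
      rw [map_mul, map_inv, map_mul, map_mul, mul_inv_eq_one, FreeGroup.lift_apply_of,
        FreeGroup.lift_apply_of]
      rfl
    | betaGamma =>
      rw [map_mul, map_inv, map_mul, map_mul, map_mul, map_pow, mul_inv_eq_one,
        FreeGroup.lift_apply_of, FreeGroup.lift_apply_of, FreeGroup.lift_apply_of]
      ext1 ⟨j, k⟩
      rw [Perm.mul_apply, Perm.mul_apply, Perm.mul_apply, modelAlpha_pow_apply]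
      -- On the sheet `j = 0` the two sides differ by `2t`, which vanishes modulo `2n`; on the other
      -- sheet they agree outright.
      cases j
      · simp
        linear_combination ht
      · simp)

/-- The relations alone only bound the order of `α` from above; the concrete model shows that no
collapse occurs. -/
theorem dvd_of_alpha_pow_eq_one {k : ℕ} (h : alpha F ^ k = 1) : 2 * n ∣ k := by
  have hm : model F (alpha F) = modelAlpha n := PresentedGroup.toGroup.of _
  have h1 : (modelAlpha n ^ k) (false, 0) = (false, 0) := by
    rw [← hm, ← map_pow, h, map_one]; rfl
  rw [modelAlpha_pow_apply, Prod.mk.injEq, zero_add] at h1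
  exact (ZMod.natCast_eq_zero_iff _ _).1 h1.2

theorem alpha_pow_two_mul : alpha F ^ (2 * n) = 1 :=
  PresentedGroup.one_of_mem (x := FreeGroup.of Gen.a ^ (2 * n)) Family.IsRel.alpha

variable {F}

/-- The order is reversed because the group acts on the right while permutations compose as
functions. -/
theorem act_mul (g h : BurnGroup F) : act (g * h) = act h * act g := by
  ext x
  induction x using Quotient.inductionOn with
  | h a => exact congrArg coset (mul_assoc a g h).symm

theorem act_one : act (1 : BurnGroup F) = 1 := by
  ext x
  induction x using Quotient.inductionOn with
  | h a => exact congrArg coset (mul_one a)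

theorem act_inv (g : BurnGroup F) : act g⁻¹ = (act g)⁻¹ := by
  rw [eq_inv_iff_mul_eq_one, ← act_mul, mul_inv_cancel, act_one]

theorem act_pow (g : BurnGroup F) (k : ℕ) : act (g ^ k) = act g ^ k := by
  induction k with
  | zero => rw [pow_zero, pow_zero, act_one]
  | succ k ih => rw [pow_succ', act_mul, ih, pow_succ]

theorem act_apply_one (g : BurnGroup F) : act g 1 = coset g := by
  change act g (coset 1) = _
  rw [act_coset, one_mul]

theorem coset_eq_one_iff {g : BurnGroup F} : coset g = 1 ↔ g = 1 ∨ g = beta F := by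
  rw [← mem_zpowers_beta]
  exact eq_comm.trans ((coset_eq_iff F).trans (by rw [inv_one, mul_one]))

theorem alpha_pow_two_ne_one (hn : 2 < n) : alpha F ^ 2 ≠ 1 := fun h => by
  have := Nat.le_of_dvd (by omega) (dvd_of_alpha_pow_eq_one F h)
  omega

theorem alpha_pow_four_ne_one (hn : 2 < n) : alpha F ^ 4 ≠ 1 := fun h => by
  have := Nat.le_of_dvd (by omega) (dvd_of_alpha_pow_eq_one F h)
  omega

theorem alpha_pow_ne_one (hn : 2 < n) : alpha F ^ n ≠ 1 := fun h => by
  have := Nat.le_of_dvd (by omega) (dvd_of_alpha_pow_eq_one F h)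
  omega

theorem alpha_mul_beta : alpha F * beta F = beta F * (alpha F)⁻¹ := by
  have := beta_zpow F (-1)
  simpa using this.symm

/-- The only nontrivial candidate is `β`, which would have to fix the coset of `α`. This puts `α β
α⁻¹ = α² β` into `⟨β⟩`, against its parity or against `α² ≠ 1`. -/
theorem act_eq_one (hn : 2 < n) {g : BurnGroup F} (h : act g = 1) : g = 1 := by
  have h1 : coset g = 1 := by rw [← act_apply_one, h]; rfl
  rcases coset_eq_one_iff.1 h1 with h1 | rfl
  · exact h1
  · have h2 : act (beta F) (coset (alpha F)) = coset (alpha F) := by rw [h]; rfl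
    rw [act_coset, coset_eq_iff, mem_zpowers_beta, mul_inv_rev, ← mul_assoc] at h2
    exfalso
    have hc : alpha F * (beta F)⁻¹ * (alpha F)⁻¹ = alpha F ^ 2 * beta F := by
      rw [inv_eq_of_mul_eq_one_left (generator_relations F).2.1, mul_assoc, ← alpha_mul_beta,
        ← mul_assoc, pow_two]
    rw [hc] at h2
    rcases h2 with h2 | h2
    · have := congrArg (parity F) h2
      rw [map_mul, map_pow, parity_alpha, parity_beta, map_one] at this
      exact absurd this (by decide)
    · exact alpha_pow_two_ne_one hn (mul_eq_right.1 h2)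

theorem act_injective (hn : 2 < n) : Function.Injective (act : BurnGroup F → Perm (BurnLoop F)) := by
  intro g h e
  rw [← mul_inv_eq_one]
  apply act_eq_one hn
  rw [act_mul, act_inv, e, inv_mul_cancel]

/-! ### The section and the left nucleus -/

theorem leftTrans_eq_act (x : BurnLoop F) : leftTrans x = act (rep x) :=
  Equiv.ext fun _ => rfl

theorem burnLoop_mul (x y : BurnLoop F) : x * y = act (rep x) y := rfl

theorem rep_coset {s : BurnGroup F} (hs : s ∈ sectionSet F) : rep (coset s) = s := rep_eq F hs rfl

theorem alpha_mul_beta_mem : alpha F * beta F ∈ sectionSet F := Or.inr (Or.inl ⟨0, by simp⟩)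

theorem beta_mul_gamma_mem : beta F * gamma F ∈ sectionSet F := Or.inr (Or.inr ⟨0, by simp⟩)

theorem alpha_mul_beta_mul_gamma_mem : alpha F * beta F * gamma F ∈ sectionSet F :=
  Or.inr (Or.inr ⟨1, by simp⟩)

theorem one_mem_sectionSet : (1 : BurnGroup F) ∈ sectionSet F := Or.inl ⟨0, by simp⟩

/-- The parity group is abelian of exponent 2, so the two factors `s` cancel. This is the source of
the Bol identity. -/
theorem mul_mul_mem_sectionSet {s t : BurnGroup F} (ht : t ∈ sectionSet F) :
    s * t * s ∈ sectionSet F := by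
  have key : ∀ a b : Multiplicative (ZMod 2 × ZMod 2 × ZMod 2), a * b * a = b := by decide
  rw [mem_section_iff] at ht ⊢
  rwa [map_mul, map_mul, key]

theorem conj_mem_sectionSet {s : BurnGroup F} (g : BurnGroup F) (hs : s ∈ sectionSet F) :
    g * s * g⁻¹ ∈ sectionSet F := by
  rw [mem_section_iff] at hs ⊢
  rwa [map_mul, map_mul, map_inv, mul_inv_cancel_comm]

theorem mul_mem_sectionSet {h s : BurnGroup F} (hh : parity F h = 1) (hs : s ∈ sectionSet F) :
    s * h ∈ sectionSet F := by
  rw [mem_section_iff] at hs ⊢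
  rwa [map_mul, hh, mul_one]

/-- The set of section parities has no nonzero period; the elements `1`, `αβ`, `βγ` suffice to
detect this. -/
theorem parity_eq_one_of_section_mul {h : BurnGroup F}
    (hh : ∀ s ∈ sectionSet F, s * h ∈ sectionSet F) : parity F h = 1 := by
  have key : ∀ p : Multiplicative (ZMod 2 × ZMod 2 × ZMod 2), p ∈ sectionParities →
      Multiplicative.ofAdd (1, 1, 0) * p ∈ sectionParities →
      Multiplicative.ofAdd (0, 1, 1) * p ∈ sectionParities → p = 1 := by decide
  have h1 := hh 1 one_mem_sectionSet
  have h2 := hh _ alpha_mul_beta_mem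
  have h3 := hh _ beta_mul_gamma_mem
  rw [mem_section_iff] at h1 h2 h3
  rw [one_mul] at h1
  rw [map_mul, map_mul, parity_alpha, parity_beta] at h2
  rw [map_mul, map_mul, parity_gamma, parity_beta] at h3
  exact key _ h1 h2 h3

theorem exists_zpow_of_parity_eq_one {g : BurnGroup F} (h : parity F g = 1) :
    ∃ i : ℤ, g = alpha F ^ (2 * i) := by
  have key : ∀ p : Multiplicative (ZMod 2 × ZMod 2 × ZMod 2), p ^ (2 : ℤ) = 1 := by decide
  -- Trivial parity is a section parity, so only the three explicit shapes of section elements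
  -- remain, and two of them contain an odd power of `β`.
  have hg : g ∈ sectionSet F := by rw [mem_section_iff, h]; decide
  rcases hg with hg | ⟨j, rfl⟩ | ⟨k, rfl⟩
  · exact hg
  · rw [map_mul, map_zpow, zpow_add, zpow_mul, key, parity_alpha, parity_beta, one_zpow] at h
    exact absurd h (by decide)
  · have key2 : ∀ p : Multiplicative (ZMod 2 × ZMod 2 × ZMod 2),
        p = 1 ∨ p = Multiplicative.ofAdd (1, 0, 0) →
        p * Multiplicative.ofAdd (0, 1, 0) * Multiplicative.ofAdd (0, 0, 1) ≠ 1 := by decide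
    refine absurd h ?_
    rw [map_mul, map_mul, parity_beta, parity_gamma]
    apply key2
    obtain ⟨i, rfl | rfl⟩ := Int.even_or_odd' k
    · left; rw [map_zpow, zpow_mul, key, one_zpow]
    · right; rw [map_zpow, zpow_add, zpow_mul, key, one_zpow, one_mul, zpow_one, parity_alpha]

theorem parity_alpha_sq : parity F (alpha F ^ 2) = 1 := by
  rw [map_pow, parity_alpha]; decide

/-- Every element of the section has order dividing `n` or `4`. -/
theorem pow_eq_one_of_mem_sectionSet {s : BurnGroup F} (hs : s ∈ sectionSet F) :
    s ^ n = 1 ∨ s ^ 4 = 1 := by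
  obtain ⟨-, hb, hc, hac, -⟩ := generator_relations F
  have hinv : ∀ k : ℤ, (alpha F ^ k * beta F) * (alpha F ^ k * beta F) = 1 := fun k => by
    rw [mul_assoc, ← mul_assoc (beta F), beta_zpow, mul_assoc, hb, mul_one, ← zpow_add,
      add_neg_cancel, zpow_zero]
  rcases hs with ⟨i, rfl⟩ | ⟨j, rfl⟩ | ⟨k, rfl⟩
  · left
    rw [← zpow_natCast, ← zpow_mul, show 2 * i * (n : ℤ) = ((2 * n : ℕ) : ℤ) * i by push_cast; ring,
      zpow_mul, zpow_natCast, alpha_pow_two_mul, one_zpow]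
  · right
    rw [show 4 = 2 * 2 from rfl, pow_mul, pow_two (_ * _), hinv, one_pow]
  · right
    -- Moving `γ` past the involution `α^k β` costs a factor `α^t`. As `t` is `0` or `n`, squaring
    -- once more gives `1`.
    have h2 : (alpha F ^ k * beta F * gamma F) ^ 2 = alpha F ^ (-(F.twist : ℤ)) := by
      have e : gamma F * (alpha F ^ k * beta F) =
          alpha F ^ (F.twist : ℤ) * (alpha F ^ k * beta F) * gamma F := by
        rw [← mul_assoc, gamma_zpow, mul_assoc, gamma_beta]
        simp only [← mul_assoc, ← zpow_add]
        rw [add_comm]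
      have e2 : alpha F ^ k * beta F * alpha F ^ (F.twist : ℤ) =
          alpha F ^ (-(F.twist : ℤ)) * (alpha F ^ k * beta F) := by
        rw [mul_assoc, beta_zpow]
        simp only [← mul_assoc, ← zpow_add]
        rw [add_comm]
      calc (alpha F ^ k * beta F * gamma F) ^ 2
          = alpha F ^ k * beta F * (gamma F * (alpha F ^ k * beta F)) * gamma F := by
            rw [pow_two]; simp only [mul_assoc]
        _ = (alpha F ^ k * beta F * alpha F ^ (F.twist : ℤ)) * (alpha F ^ k * beta F) *
              (gamma F * gamma F) := by rw [e]; simp only [mul_assoc]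
        _ = _ := by rw [e2, mul_assoc (alpha F ^ _), hinv, hc, mul_one, mul_one]
    rw [show 4 = 2 * 2 from rfl, pow_mul, h2, ← zpow_natCast, ← zpow_mul]
    cases F with
    | B => simp [Family.twist]
    | C h =>
      rw [show -((Family.C h).twist : ℤ) * ((2 : ℕ) : ℤ) = -((2 * n : ℕ) : ℤ) by
        simp [Family.twist]; ring, zpow_neg, zpow_natCast, alpha_pow_two_mul, inv_one]

theorem bol (x y z : BurnLoop F) : x * (y * (x * z)) = (x * (y * x)) * z := by
  have h : rep (x * (y * x)) = rep x * rep y * rep x := by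
    apply rep_eq F (mul_mul_mem_sectionSet (rep_mem F y))
    rw [← act_apply_one, act_mul, act_mul]
    change x * (y * (x * 1)) = _
    rw [mul_one]
  change _ = act (rep (x * (y * x))) z
  rw [h, act_mul, act_mul]
  rfl

/-- Multiplying a section element by an `h` of trivial parity stays in the section, so `λ_m λ_x` is
itself a left translation. -/
theorem mul_assoc_of_parity {m : BurnLoop F} (hm : parity F (rep m) = 1) (x y : BurnLoop F) :
    m * (x * y) = (m * x) * y := by
  have h : rep (m * x) = rep x * rep m := by
    apply rep_eq F (mul_mem_sectionSet hm (rep_mem F x))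
    rw [← act_apply_one, act_mul]
    change m * (x * 1) = _
    rw [mul_one]
  change _ = act (rep (m * x)) y
  rw [h, act_mul]
  rfl

/-- Converse of `mul_assoc_of_parity`: for `m` in the left nucleus each `λ_m λ_x` is a left
translation, and faithfulness carries this back to the section. -/
theorem parity_rep_nucleus (hn : 2 < n) (m : LeftNucleus (BurnLoop F)) :
    parity F (rep m.1) = 1 := by
  refine parity_eq_one_of_section_mul fun s hs => ?_
  have h : act (s * rep m.1) = act (rep (m.1 * coset s)) := by
    rw [act_mul]
    ext y
    have := m.2 (coset s) y
    rwa [burnLoop_mul (coset s), rep_coset hs] at this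
  rw [act_injective hn h]
  exact rep_mem F _

/-! ### The groups `G(L)` and `⟨α, γ⟩` -/

theorem act_mem_leftMultGroup (g : BurnGroup F) : act g ∈ leftMultGroup (BurnLoop F) := by
  let H : Subgroup (BurnGroup F) :=
    { carrier := {g | act g ∈ leftMultGroup (BurnLoop F)}
      mul_mem' := fun {a b} ha hb => by
        change act (a * b) ∈ leftMultGroup (BurnLoop F)
        rw [act_mul]; exact mul_mem hb ha
      one_mem' := by
        change act 1 ∈ leftMultGroup (BurnLoop F)
        rw [act_one]; exact one_mem _
      inv_mem' := fun {a} ha => by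
        change act a⁻¹ ∈ leftMultGroup (BurnLoop F)
        rw [act_inv]; exact inv_mem ha }
  have hS : ∀ s ∈ sectionSet F, s ∈ H := fun s hs =>
    Subgroup.subset_closure ⟨coset s, by rw [leftTrans_eq_act, rep_coset hs]⟩
  have hbc := hS _ beta_mul_gamma_mem
  -- The section generates the group: `α = (αβγ)(βγ)⁻¹`, and then `β` and `γ` follow from `αβ` and
  -- `βγ`.
  have ha : alpha F ∈ H := by
    have := hS _ alpha_mul_beta_mul_gamma_mem
    rw [mul_assoc] at this
    exact (Subgroup.mul_mem_cancel_right H hbc).1 this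
  have hb : beta F ∈ H := (Subgroup.mul_mem_cancel_left H ha).1 (hS _ alpha_mul_beta_mem)
  have hc : gamma F ∈ H := (Subgroup.mul_mem_cancel_left H hb).1 hbc
  change g ∈ H
  obtain ⟨k, rfl | rfl | rfl | rfl⟩ := normal_form F g
  · exact zpow_mem ha k
  · exact mul_mem (zpow_mem ha k) hc
  · exact mul_mem (zpow_mem ha k) hb
  · exact mul_mem (mul_mem (zpow_mem ha k) hb) hc

theorem mem_leftMultGroup_iff {v : Perm (BurnLoop F)} :
    v ∈ leftMultGroup (BurnLoop F) ↔ ∃ g : BurnGroup F, v = act g := by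
  constructor
  · intro hv
    induction hv using Subgroup.closure_induction with
    | mem x hx => obtain ⟨y, rfl⟩ := hx; exact ⟨_, leftTrans_eq_act y⟩
    | one => exact ⟨1, act_one.symm⟩
    | mul x y _ _ hx hy =>
      obtain ⟨g, rfl⟩ := hx
      obtain ⟨h, rfl⟩ := hy
      exact ⟨h * g, (act_mul h g).symm⟩
    | inv x _ hx =>
      obtain ⟨g, rfl⟩ := hx
      exact ⟨g⁻¹, (act_inv g).symm⟩
  · rintro ⟨g, rfl⟩
    exact act_mem_leftMultGroup g

theorem lambdaZero_le_leftMultGroup : lambdaZero F ≤ leftMultGroup (BurnLoop F) := by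
  refine (Subgroup.closure_le _).2 ?_
  rintro _ (rfl | rfl) <;> exact act_mem_leftMultGroup _

theorem act_alpha_zpow_mem (k : ℤ) : act (alpha F ^ k) ∈ lambdaZero F := by
  have ha : act (alpha F) ∈ lambdaZero F := Subgroup.subset_closure (Or.inl rfl)
  cases k with
  | ofNat k => rw [Int.ofNat_eq_natCast, zpow_natCast, act_pow]; exact pow_mem ha k
  | negSucc k => rw [zpow_negSucc, act_inv, act_pow]; exact inv_mem (pow_mem ha _)

theorem act_alpha_zpow_mul_gamma_mem (k : ℤ) : act (alpha F ^ k * gamma F) ∈ lambdaZero F := by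
  rw [act_mul]
  exact mul_mem (Subgroup.subset_closure (Or.inr rfl)) (act_alpha_zpow_mem k)

theorem lambdaZero_comm {v w : Perm (BurnLoop F)} (hv : v ∈ lambdaZero F) (hw : w ∈ lambdaZero F) :
    v * w = w * v := by
  have hac : act (alpha F) * act (gamma F) = act (gamma F) * act (alpha F) := by
    rw [← act_mul, ← act_mul, (generator_relations F).2.2.2.1]
  have h1 : lambdaZero F ≤ Subgroup.centralizer {act (alpha F), act (gamma F)} := by
    refine (Subgroup.closure_le _).2 ?_
    rintro _ (rfl | rfl) <;> rw [SetLike.mem_coe, Subgroup.mem_centralizer_iff] <;>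
      rintro _ (rfl | rfl)
    · rfl
    · exact hac.symm
    · exact hac
    · rfl
  have h2 : lambdaZero F ≤ Subgroup.centralizer (lambdaZero F : Set (Perm (BurnLoop F))) := by
    refine (Subgroup.closure_le _).2 ?_
    intro z hz
    rw [SetLike.mem_coe, Subgroup.mem_centralizer_iff]
    intro y hy
    exact (Subgroup.mem_centralizer_iff.1 (h1 hy) z hz).symm
  exact (Subgroup.mem_centralizer_iff.1 (h2 hv) w hw).symm

theorem act_mem_lambdaZero_of_parity {h : BurnGroup F} (hh : parity F h = 1) :
    act h ∈ lambdaZero F := by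
  obtain ⟨i, rfl⟩ := exists_zpow_of_parity_eq_one hh
  exact act_alpha_zpow_mem _

/-- An element of `G(L)` that commutes with `α ^ 2` lies in `⟨α, γ⟩`. -/
theorem mem_lambdaZero_of_commute (hn : 2 < n) {v : Perm (BurnLoop F)}
    (hv : v ∈ leftMultGroup (BurnLoop F))
    (hc : v * act (alpha F ^ 2) = act (alpha F ^ 2) * v) : v ∈ lambdaZero F := by
  obtain ⟨g, rfl⟩ := mem_leftMultGroup_iff.1 hv
  rw [← act_mul, ← act_mul] at hc
  have hc : Commute (alpha F ^ 2) g := act_injective hn hc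
  have hcomm : ∀ k : ℤ, Commute (alpha F ^ 2) (alpha F ^ k) := fun k =>
    ((Commute.refl (alpha F)).pow_left 2).zpow_right k
  have hgam : Commute (alpha F ^ 2) (gamma F) :=
    Commute.pow_left (generator_relations F).2.2.2.1 2
  -- `β` inverts `α²`, so commuting with it would force `α⁴ = 1`.
  have hbeta : ¬ Commute (alpha F ^ 2) (beta F) := fun h => by
    have h1 := beta_zpow F 2
    have h : alpha F ^ 2 * beta F = beta F * alpha F ^ 2 := h
    rw [zpow_ofNat, ← h] at h1
    have h2 := mul_right_cancel h1
    apply alpha_pow_four_ne_one (F := F) hn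
    rw [zpow_neg, eq_inv_iff_mul_eq_one, zpow_ofNat, ← pow_add] at h2
    exact h2
  obtain ⟨k, rfl | rfl | rfl | rfl⟩ := normal_form F g
  · exact act_alpha_zpow_mem k
  · exact act_alpha_zpow_mul_gamma_mem k
  · refine absurd ?_ hbeta
    simpa using (hcomm k).inv_right.mul_right hc
  · refine absurd ?_ hbeta
    simpa [mul_assoc] using ((hcomm k).inv_right.mul_right hc).mul_right hgam.inv_right

/-- `⟨α, γ⟩` meets every right coset of `⟨β⟩`. -/
theorem exists_lambdaZero_apply_one (b : BurnLoop F) : ∃ v ∈ lambdaZero F, v 1 = b := by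
  have hb : ∀ g : BurnGroup F, coset (beta F * g) = coset g := fun g => by
    rw [coset_eq_iff, mul_inv_rev, mul_inv_cancel_left]
    exact inv_mem (Subgroup.mem_zpowers _)
  induction b using Quotient.inductionOn with
  | h g =>
    change ∃ v ∈ lambdaZero F, v 1 = coset g
    obtain ⟨k, rfl | rfl | rfl | rfl⟩ := normal_form F g
    · exact ⟨_, act_alpha_zpow_mem k, act_apply_one _⟩
    · exact ⟨_, act_alpha_zpow_mul_gamma_mem k, act_apply_one _⟩
    -- `α^k β = β α^{-k}` lies in the right coset of `α^{-k}`.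
    · refine ⟨_, act_alpha_zpow_mem (-k), ?_⟩
      have := beta_zpow F (-k)
      rw [neg_neg] at this
      rw [act_apply_one, ← this, hb]
    · refine ⟨_, act_alpha_zpow_mul_gamma_mem (-k), ?_⟩
      have := beta_zpow F (-k)
      rw [neg_neg] at this
      rw [act_apply_one, ← this, mul_assoc, hb]

/-- The `β`-parity vanishes on both generators. It serves to separate `⟨α, γ⟩` from `β`, the only
nontrivial element fixing the unit coset. -/
theorem exists_eq_act_of_mem_lambdaZero {v : Perm (BurnLoop F)} (hv : v ∈ lambdaZero F) :
    ∃ g : BurnGroup F, v = act g ∧ (parity F g).toAdd.2.1 = 0 := by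
  induction hv using Subgroup.closure_induction with
  | mem x hx =>
    rcases hx with rfl | rfl
    · exact ⟨_, rfl, by rw [parity_alpha]; rfl⟩
    · exact ⟨_, rfl, by rw [parity_gamma]; rfl⟩
  | one => exact ⟨1, act_one.symm, by rw [map_one]; rfl⟩
  | mul x y _ _ hx hy =>
    obtain ⟨g, rfl, hg⟩ := hx
    obtain ⟨h, rfl, hh⟩ := hy
    exact ⟨h * g, (act_mul h g).symm, by simp [hg, hh]⟩
  | inv x _ hx =>
    obtain ⟨g, rfl, hg⟩ := hx
    exact ⟨g⁻¹, (act_inv g).symm, by simp [hg]⟩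

theorem eq_one_of_mem_lambdaZero {v : Perm (BurnLoop F)} (hv : v ∈ lambdaZero F) (h : v 1 = 1) :
    v = 1 := by
  obtain ⟨g, rfl, hg⟩ := exists_eq_act_of_mem_lambdaZero hv
  rw [act_apply_one, coset_eq_one_iff] at h
  rcases h with rfl | rfl
  · exact act_one
  · rw [parity_beta] at hg
    exact absurd hg (by decide)

end burn

end BurnNet

namespace BurnNet

open Equiv (Perm)

section burn

variable {n : ℕ} {F : Family n}

/-! ### The autotopisms of the loops -/

theorem alpha_mul_gamma_pow_ne_one (hn : 2 < n) :
    (alpha F * gamma F) ^ n ≠ 1 ∧ (alpha F * gamma F) ^ 4 ≠ 1 := by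
  obtain ⟨-, -, hc, hac, -⟩ := generator_relations F
  have hc2 : ∀ k, gamma F ^ (2 * k) = 1 := fun k => by rw [pow_mul, pow_two, hc, one_pow]
  have hpow : ∀ k, (alpha F * gamma F) ^ k = alpha F ^ k * gamma F ^ k :=
    (show Commute (alpha F) (gamma F) from hac).mul_pow
  constructor
  · intro h
    obtain ⟨k, hk | hk⟩ := Nat.even_or_odd' n
    · have hg : gamma F ^ n = 1 := (congrArg (gamma F ^ ·) hk).trans (hc2 k)
      rw [hpow, hg, mul_one] at h
      exact alpha_pow_ne_one hn h
    · have key : ∀ p : Multiplicative (ZMod 2 × ZMod 2 × ZMod 2), p ^ 2 = 1 := by decide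
      have hp : parity F (alpha F * gamma F) ^ n = 1 := by rw [← map_pow, h, map_one]
      have hp' : parity F (alpha F * gamma F) ^ (2 * k + 1) = 1 :=
        (congrArg (parity F (alpha F * gamma F) ^ ·) hk).symm.trans hp
      rw [pow_succ, pow_mul, key, one_pow, one_mul, map_mul, parity_alpha, parity_gamma] at hp'
      exact absurd hp' (by decide)
  · rw [hpow, hc2 2, mul_one]
    exact alpha_pow_four_ne_one hn

/-- The first component of an autotopism maps the unit into the left nucleus. -/
theorem parity_rep_fst_one (hn : 2 < n) {f : Perm (BurnLoop F) × Perm (BurnLoop F)}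
    (hf : f ∈ autotopismPairs (BurnLoop F)) : parity F (rep (f.1 1)) = 1 := by
  -- Choosing `x` with `f.1 x` the coset of `g a`, where `a` represents `f.1 1`, turns `λ_{u 1}⁻¹
  -- λ_{u x}` into the action of `g`.
  have hpow : ∀ g, g * rep (f.1 1) ∈ sectionSet F → g ^ n = 1 ∨ g ^ 4 = 1 := fun g hg => by
    obtain ⟨x, hx⟩ := f.1.surjective (coset (g * rep (f.1 1)))
    have hc := conj_leftTrans hf x
    rw [hx, leftTrans_eq_act, leftTrans_eq_act, leftTrans_eq_act, rep_coset hg, act_mul,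
      inv_mul_cancel_left] at hc
    have hk : ∀ k, rep x ^ k = 1 → g ^ k = 1 := fun k hk => by
      apply act_eq_one hn
      rw [act_pow, ← hc, conj_pow, ← act_pow, hk, act_one, mul_one, mul_inv_cancel]
    exact (pow_eq_one_of_mem_sectionSet (rep_mem F x)).imp (hk n) (hk 4)
  -- Of the nonzero section parities, `(0, 1, 1)` and `(1, 1, 1)` are excluded by `α`, and `(1, 1,
  -- 0)` by `αγ`.
  have key : ∀ p : Multiplicative (ZMod 2 × ZMod 2 × ZMod 2), p ∈ sectionParities →
      Multiplicative.ofAdd (1, 0, 0) * p ∉ sectionParities →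
      Multiplicative.ofAdd (1, 0, 0) * Multiplicative.ofAdd (0, 0, 1) * p ∉ sectionParities →
      p = 1 := by decide
  refine key _ ((mem_section_iff F _).1 (rep_mem F _)) (fun h => ?_) fun h => ?_
  · rw [← parity_alpha, ← map_mul, ← mem_section_iff] at h
    exact (hpow _ h).elim (alpha_pow_ne_one hn) (alpha_pow_four_ne_one hn)
  · rw [← parity_alpha F, ← parity_gamma F, ← map_mul, ← map_mul, ← mem_section_iff] at h
    exact (hpow _ h).elim (alpha_mul_gamma_pow_ne_one hn).1 (alpha_mul_gamma_pow_ne_one hn).2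

/-- The second component of an autotopism normalizes the section. -/
theorem exists_conj_act_eq (hn : 2 < n) {f : Perm (BurnLoop F) × Perm (BurnLoop F)}
    (hf : f ∈ autotopismPairs (BurnLoop F)) {s : BurnGroup F} (hs : s ∈ sectionSet F) :
    ∃ t ∈ sectionSet F, f.2 * act s * f.2⁻¹ = act t := by
  have hc := conj_leftTrans hf (coset s)
  rw [leftTrans_eq_act, leftTrans_eq_act, leftTrans_eq_act, rep_coset hs, ← act_inv,
    ← act_mul] at hc
  exact ⟨_, mul_mem_sectionSet (by rw [map_inv, parity_rep_fst_one hn hf, inv_one])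
    (rep_mem F _), hc⟩

/-- Trivial parity is characterized by `S h ⊆ S`, and conjugation by the second component preserves
`S` in both directions. -/
theorem exists_conj_act_parity_eq_one (hn : 2 < n) {f : Perm (BurnLoop F) × Perm (BurnLoop F)}
    (hf : f ∈ autotopismPairs (BurnLoop F)) {h : BurnGroup F} (hh : parity F h = 1) :
    ∃ t, parity F t = 1 ∧ f.2 * act h * f.2⁻¹ = act t := by
  have hS : h ∈ sectionSet F := by
    rw [← one_mul h]
    exact mul_mem_sectionSet hh one_mem_sectionSet
  obtain ⟨t, -, ht⟩ := exists_conj_act_eq hn hf hS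
  refine ⟨t, parity_eq_one_of_section_mul fun s hs => ?_, ht⟩
  obtain ⟨r, hr, hr'⟩ := exists_conj_act_eq hn (inv_mem hf) hs
  obtain ⟨q, hq, hq'⟩ := exists_conj_act_eq hn hf (mul_mem_sectionSet hh hr)
  have : act (s * t) = act q := by
    rw [← hq', act_mul, act_mul, ← ht, ← hr']
    change _ = f.2 * (act h * (f.2⁻¹ * act s * f.2⁻¹⁻¹)) * f.2⁻¹
    group
  rwa [act_injective hn this]

/-- The second components of the autotopisms normalize `⟨α, γ⟩`. -/
theorem conj_mem_lambdaZero (hn : 2 < n) {f : Perm (BurnLoop F) × Perm (BurnLoop F)}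
    (hf : f ∈ autotopismPairs (BurnLoop F)) {z : Perm (BurnLoop F)} (hz : z ∈ lambdaZero F) :
    f.2 * z * f.2⁻¹ ∈ lambdaZero F := by
  refine mem_lambdaZero_of_commute hn
    (conj_mem_leftMultGroup hf (lambdaZero_le_leftMultGroup hz)) ?_
  -- Pulled back by the autotopism, `α²` still lies in `⟨α²⟩` and hence commutes with `z`.
  obtain ⟨t, ht, hft⟩ := exists_conj_act_parity_eq_one hn (inv_mem hf) parity_alpha_sq
  have hcomm := lambdaZero_comm hz (act_mem_lambdaZero_of_parity ht)
  have hft : act (alpha F ^ 2) = f.2 * act t * f.2⁻¹ := by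
    rw [← hft]
    change _ = f.2 * (f.2⁻¹ * _ * f.2⁻¹⁻¹) * f.2⁻¹
    group
  rw [hft]
  calc f.2 * z * f.2⁻¹ * (f.2 * act t * f.2⁻¹) = f.2 * (z * act t) * f.2⁻¹ := by group
    _ = f.2 * (act t * z) * f.2⁻¹ := by rw [hcomm]
    _ = _ := by group

/-! ### The group `M` -/

theorem lambdaGroup_le_autotopismPairs : lambdaGroup F ≤ autotopismPairs (BurnLoop F) :=
  fun _ hf => bolGroup_le_autotopismPairs bol (mem_bolPreimage.1 hf).1

-- Given an autotopism `(u, v)` with `v ∈ ⟨α, γ⟩`, lift `v` to some `(u', v)` in `Λ`. The quotient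
-- has trivial second component, so it lies in `T`; thus the product set `TΛ` already is the whole
-- group.
variable (F) in
theorem mPairs_eq_and_mul_eq :
    mPairs F = autotopismPairs (BurnLoop F) ⊓
      (lambdaZero F).comap (MonoidHom.snd (Perm (BurnLoop F)) (Perm (BurnLoop F))) ∧
    (mPairs F : Set (Perm (BurnLoop F) × Perm (BurnLoop F))) =
      (nucleusGroup (BurnLoop F) : Set (Perm (BurnLoop F) × Perm (BurnLoop F))) *
        (lambdaGroup F : Set (Perm (BurnLoop F) × Perm (BurnLoop F))) := by
  have h1 : mPairs F ≤ autotopismPairs (BurnLoop F) ⊓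
      (lambdaZero F).comap (MonoidHom.snd (Perm (BurnLoop F)) (Perm (BurnLoop F))) := by
    refine sup_le (le_inf nucleusGroup_le_autotopismPairs ?_)
      (le_inf lambdaGroup_le_autotopismPairs fun f hf => (mem_bolPreimage.1 hf).2)
    rintro _ ⟨m, rfl⟩
    exact one_mem (lambdaZero F)
  have h2 : ∀ f, f ∈ autotopismPairs (BurnLoop F) ⊓
      (lambdaZero F).comap (MonoidHom.snd (Perm (BurnLoop F)) (Perm (BurnLoop F))) →
      f ∈ (nucleusGroup (BurnLoop F) : Set (Perm (BurnLoop F) × Perm (BurnLoop F))) *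
        (lambdaGroup F : Set (Perm (BurnLoop F) × Perm (BurnLoop F))) := by
    rintro ⟨u, v⟩ ⟨hf, hv⟩
    obtain ⟨u', hu'⟩ := exists_mem_bolGroup (lambdaZero_le_leftMultGroup hv)
    have hΛ : (u', v) ∈ lambdaGroup F := mem_bolPreimage.2 ⟨hu', hv⟩
    exact Set.mem_mul.2 ⟨(u, v) * (u', v)⁻¹,
      mem_nucleusGroup_of_snd_eq_one
        (mul_mem hf (inv_mem (lambdaGroup_le_autotopismPairs hΛ))) (mul_inv_cancel v),
      _, hΛ, inv_mul_cancel_right _ _⟩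
  have h3 : (nucleusGroup (BurnLoop F) : Set (Perm (BurnLoop F) × Perm (BurnLoop F))) *
        (lambdaGroup F : Set (Perm (BurnLoop F) × Perm (BurnLoop F))) ⊆ mPairs F :=
    Set.mul_subset_iff.2 fun _ ha _ hb =>
      mul_mem ((le_sup_left : nucleusGroup _ ≤ mPairs F) ha)
        ((le_sup_right : lambdaGroup F ≤ mPairs F) hb)
  exact ⟨le_antisymm h1 fun f hf => h3 (h2 f hf), Set.Subset.antisymm (fun f hf => h2 f (h1 hf)) h3⟩

/-- `M` consists of the autotopisms whose second component lies in `⟨α, γ⟩`. -/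
theorem mem_mPairs {f : Perm (BurnLoop F) × Perm (BurnLoop F)} :
    f ∈ mPairs F ↔ f ∈ autotopismPairs (BurnLoop F) ∧ f.2 ∈ lambdaZero F := by
  rw [(mPairs_eq_and_mul_eq F).1]
  rfl

theorem mPairs_normal (hn : 2 < n) {f m : Perm (BurnLoop F) × Perm (BurnLoop F)}
    (hf : f ∈ autotopismPairs (BurnLoop F)) (hm : m ∈ mPairs F) : f * m * f⁻¹ ∈ mPairs F := by
  rw [mem_mPairs] at hm ⊢
  exact ⟨mul_mem (mul_mem hf hm.1) (inv_mem hf), conj_mem_lambdaZero hn hf hm.2⟩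

theorem mPairs_free {m : Perm (BurnLoop F) × Perm (BurnLoop F)} (hm : m ∈ mPairs F)
    (h1 : m.1 1 = 1) (h2 : m.2 1 = 1) : m = 1 := by
  rw [mem_mPairs] at hm
  have hv := eq_one_of_mem_lambdaZero hm.2 h2
  obtain ⟨k, rfl⟩ := mem_nucleusGroup_of_snd_eq_one hm.1 hv
  have hk : k = 1 := Subtype.ext ((mul_one k.1).symm.trans h1)
  rw [hk, map_one]

theorem mPairs_transitive (hn : 2 < n) {f : Perm (BurnLoop F) × Perm (BurnLoop F)}
    (hf : f ∈ autotopismPairs (BurnLoop F)) :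
    ∃ m ∈ mPairs F, m.1 1 = f.1 1 ∧ m.2 1 = f.2 1 := by
  obtain ⟨v, hv, hv1⟩ := exists_lambdaZero_apply_one (f.2 1)
  obtain ⟨u, hu⟩ := exists_mem_bolGroup (lambdaZero_le_leftMultGroup hv)
  have hg : (u, v) ∈ autotopismPairs (BurnLoop F) := bolGroup_le_autotopismPairs bol hu
  -- Both first coordinates lie in the left nucleus, so translation by `a b⁻¹` moves `u 1 = b` to
  -- `f.1 1 = a` without touching the second coordinate.
  let a : LeftNucleus (BurnLoop F) := ⟨f.1 1, mul_assoc_of_parity (parity_rep_fst_one hn hf)⟩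
  let b : LeftNucleus (BurnLoop F) := ⟨u 1, mul_assoc_of_parity (parity_rep_fst_one hn hg)⟩
  refine ⟨nucleusHom (a * b⁻¹) * (u, v), mem_mPairs.2
    ⟨mul_mem (nucleusGroup_le_autotopismPairs ⟨_, rfl⟩) hg, ?_⟩, ?_, hv1⟩
  · change 1 * v ∈ lambdaZero F
    rwa [one_mul]
  · exact congrArg Subtype.val (inv_mul_cancel_right a b)

/-! ### The isomorphism of `M` with `N_λ × ⟨α, γ⟩` -/

/-- For `v` in `⟨α, γ⟩`, the map `c_v` with `λ_{c_v x} = v λ_x v⁻¹`. -/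
noncomputable def lambdaConj (v : Perm (BurnLoop F)) (x : BurnLoop F) : BurnLoop F :=
  v (x * v⁻¹ 1)

/-- The section is closed under conjugation, so `v λ_x v⁻¹` is a left translation; its value at the
unit is `v (x * v⁻¹ 1)`. -/
theorem leftTrans_lambdaConj {v : Perm (BurnLoop F)} (hv : v ∈ lambdaZero F) (x : BurnLoop F) :
    leftTrans (lambdaConj v x) = v * leftTrans x * v⁻¹ := by
  obtain ⟨g, rfl⟩ := mem_leftMultGroup_iff.1 (lambdaZero_le_leftMultGroup hv)
  have h : act g * leftTrans x * (act g)⁻¹ = act (g⁻¹ * rep x * g⁻¹⁻¹) := by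
    rw [inv_inv, act_mul, act_mul, act_inv, leftTrans_eq_act, mul_assoc]
  have h2 : lambdaConj (act g) x = coset (g⁻¹ * rep x * g⁻¹⁻¹) := by
    rw [← act_apply_one, ← h]
    rfl
  rw [h, h2, leftTrans_eq_act, rep_coset (conj_mem_sectionSet _ (rep_mem F x))]

variable (F) in
/-- `v ↦ c_v` as a homomorphism into the permutations of the loop. -/
noncomputable def lambdaConjHom : lambdaZero F →* Perm (BurnLoop F) :=
  -- A homomorphism from a group to the monoid of self-maps lands in the permutations, so
  -- bijectivity of `c_v` needs no separate argument.
  MonoidHom.toHomPerm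
    { toFun := fun v => (lambdaConj v.1 : Function.End (BurnLoop F))
      map_one' := funext fun x => mul_one x
      map_mul' := fun v w => funext fun x => leftTrans_injective (by
        change leftTrans (lambdaConj (v * w).1 x) = leftTrans (lambdaConj v.1 (lambdaConj w.1 x))
        rw [leftTrans_lambdaConj (v * w).2, leftTrans_lambdaConj v.2, leftTrans_lambdaConj w.2]
        simp only [Subgroup.coe_mul, mul_inv_rev, mul_assoc]) }

theorem leftTrans_lambdaConjHom (v : lambdaZero F) (x : BurnLoop F) :
    leftTrans (lambdaConjHom F v x) = v.1 * leftTrans x * v.1⁻¹ :=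
  leftTrans_lambdaConj v.2 x

variable (F) in
/-- The splitting `v ↦ (c_v, v)` of the projection of `M` onto `⟨α, γ⟩`. -/
noncomputable def lambdaSplitting : lambdaZero F →* Perm (BurnLoop F) × Perm (BurnLoop F) :=
  (lambdaConjHom F).prod (lambdaZero F).subtype

theorem lambdaSplitting_mem (v : lambdaZero F) :
    lambdaSplitting F v ∈ autotopismPairs (BurnLoop F) := by
  -- The third component is `v` itself: `c_v x * v y = v λ_x v⁻¹ v y = v (x * y)`.
  refine ⟨v.1, fun x y => ?_⟩
  change leftTrans (lambdaConjHom F v x) (v.1 y) = _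
  rw [leftTrans_lambdaConjHom, Perm.mul_apply, ← Perm.mul_apply v.1⁻¹, inv_mul_cancel]
  rfl

theorem leftTrans_nucleus_mem_lambdaZero (hn : 2 < n) (m : LeftNucleus (BurnLoop F)) :
    leftTrans m.1 ∈ lambdaZero F := by
  rw [leftTrans_eq_act]
  exact act_mem_lambdaZero_of_parity (parity_rep_nucleus hn m)

theorem leftTrans_nucleus_mul (m : LeftNucleus (BurnLoop F)) (x : BurnLoop F) :
    leftTrans (m.1 * x) = leftTrans m.1 * leftTrans x :=
  Equiv.ext fun y => (m.2 x y).symm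

/-- `λ_m` lies in the abelian group `⟨α, γ⟩`, so conjugation by `v` fixes the factor `λ_m` of `λ_{m
x} = λ_m λ_x`. -/
theorem nucleusHom_commute_lambdaSplitting (hn : 2 < n) (m : LeftNucleus (BurnLoop F))
    (v : lambdaZero F) : Commute (nucleusHom m) (lambdaSplitting F v) := by
  refine Prod.ext (Equiv.ext fun x => leftTrans_injective ?_) ?_
  · change leftTrans (m.1 * lambdaConjHom F v x) = leftTrans (lambdaConjHom F v (m.1 * x))
    rw [leftTrans_nucleus_mul, leftTrans_lambdaConjHom, leftTrans_lambdaConjHom,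
      leftTrans_nucleus_mul]
    have := lambdaZero_comm (leftTrans_nucleus_mem_lambdaZero hn m) v.2
    simp only [← mul_assoc]
    rw [this]
  · change 1 * v.1 = v.1 * 1
    rw [one_mul, mul_one]

variable (F) in
/-- The homomorphism `(m, v) ↦ (λ_m c_v, v)`. -/
noncomputable def nucleusLambdaHom (hn : 2 < n) : LeftNucleus (BurnLoop F) × lambdaZero F →*
    Perm (BurnLoop F) × Perm (BurnLoop F) :=
  nucleusHom.noncommCoprod (lambdaSplitting F) (nucleusHom_commute_lambdaSplitting hn)

theorem nucleusLambdaHom_injective (hn : 2 < n) :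
    Function.Injective (nucleusLambdaHom F hn) := by
  rw [injective_iff_map_eq_one]
  rintro ⟨m, v⟩ h
  have h : nucleusHom m * lambdaSplitting F v = 1 := h
  have hv : v = 1 := Subtype.ext ((one_mul v.1).symm.trans (congrArg Prod.snd h))
  subst hv
  rw [map_one, mul_one] at h
  have hm : m = 1 := Subtype.ext
    ((mul_one m.1).symm.trans (DFunLike.congr_fun (congrArg Prod.fst h) 1))
  rw [hm]
  rfl

theorem range_nucleusLambdaHom (hn : 2 < n) : (nucleusLambdaHom F hn).range = mPairs F := by
  ext f
  rw [mem_mPairs]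
  constructor
  · rintro ⟨⟨m, v⟩, rfl⟩
    refine ⟨mul_mem (nucleusGroup_le_autotopismPairs ⟨m, rfl⟩) (lambdaSplitting_mem v), ?_⟩
    change 1 * v.1 ∈ lambdaZero F
    rw [one_mul]
    exact v.2
  · rintro ⟨hf, hv⟩
    -- Dividing by the splitting of the second component leaves an element of `T`.
    obtain ⟨m, hm⟩ := mem_nucleusGroup_of_snd_eq_one
      (mul_mem hf (inv_mem (lambdaSplitting_mem ⟨f.2, hv⟩))) (mul_inv_cancel f.2)
    exact ⟨(m, ⟨f.2, hv⟩), mul_eq_of_eq_mul_inv hm⟩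

theorem nucleus_mul_comm (hn : 2 < n) (a b : LeftNucleus (BurnLoop F)) : a * b = b * a := by
  refine Subtype.ext (leftTrans_injective ?_)
  change leftTrans (a.1 * b.1) = leftTrans (b.1 * a.1)
  rw [leftTrans_nucleus_mul, leftTrans_nucleus_mul]
  exact lambdaZero_comm (leftTrans_nucleus_mem_lambdaZero hn a)
    (leftTrans_nucleus_mem_lambdaZero hn b)

theorem mPairs_mul_comm (hn : 2 < n) {f g : Perm (BurnLoop F) × Perm (BurnLoop F)}
    (hf : f ∈ mPairs F) (hg : g ∈ mPairs F) : f * g = g * f := by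
  rw [← range_nucleusLambdaHom hn] at hf hg
  obtain ⟨⟨a, v⟩, rfl⟩ := hf
  obtain ⟨⟨b, w⟩, rfl⟩ := hg
  rw [← map_mul, ← map_mul, Prod.mk_mul_mk, Prod.mk_mul_mk, nucleus_mul_comm hn a b,
    show v * w = w * v from Subtype.ext (lambdaZero_comm v.2 w.2)]

theorem nonempty_mGroup_mulEquiv (hn : 2 < n) :
    Nonempty (mGroup F ≃* LeftNucleus (BurnLoop F) × lambdaZero F) :=
  ⟨((((nucleusLambdaHom F hn).ofInjective (nucleusLambdaHom_injective hn)).trans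
    (MulEquiv.subgroupCongr (range_nucleusLambdaHom hn))).trans
      ((mPairs F).equivMapOfInjective _ pairHom_injective)).symm⟩

end burn

end BurnNet

/-! ### The main theorem -/

open BurnNet
theorem mainTheorem3 (n : ℕ) (hn : 2 < n) (F : Family n) :
    -- `⟨α, γ⟩` is a subgroup of `G(L)`, and `TΛ` is a subgroup
    lambdaZero F ≤ leftMultGroup (BurnLoop F) ∧
    (mPairs F : Set (Equiv.Perm (BurnLoop F) × Equiv.Perm (BurnLoop F))) =
      (nucleusGroup (BurnLoop F) : Set (Equiv.Perm (BurnLoop F) × Equiv.Perm (BurnLoop F))) *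
        (lambdaGroup F : Set (Equiv.Perm (BurnLoop F) × Equiv.Perm (BurnLoop F))) ∧
    -- `M` is an abelian normal subgroup of the collineation group
    mGroup F ≤ collineationGroup (BurnLoop F) ∧
    ((mGroup F).subgroupOf (collineationGroup (BurnLoop F))).Normal ∧
    (∀ f ∈ mGroup F, ∀ g ∈ mGroup F, f * g = g * f) ∧
    -- it is isomorphic to `N_λ × ⟨α, γ⟩`
    Nonempty (mGroup F ≃* LeftNucleus (BurnLoop F) × lambdaZero F) ∧
    -- it acts regularly on the orbit of the origin
    (∀ P ∈ MulAction.orbit (collineationGroup (BurnLoop F)) ((1, 1) : BurnLoop F × BurnLoop F),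
      ∀ Q ∈ MulAction.orbit (collineationGroup (BurnLoop F)) ((1, 1) : BurnLoop F × BurnLoop F),
        ∃! f : mGroup F, f • P = Q) ∧
    -- the collineation group is the semidirect product of `M` and `Aut(L)`
    ∃ φ : MulAut (BurnLoop F) →* MulAut (mGroup F),
      (∀ (σ : MulAut (BurnLoop F)) (u v : Equiv.Perm (BurnLoop F))
        (h : pairHom (BurnLoop F) (u, v) ∈ mGroup F),
        (φ σ ⟨pairHom (BurnLoop F) (u, v), h⟩ : Equiv.Perm (BurnLoop F × BurnLoop F)) =
          pairHom (BurnLoop F)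
            (MulAut.toPerm _ σ * u * (MulAut.toPerm _ σ)⁻¹,
              MulAut.toPerm _ σ * v * (MulAut.toPerm _ σ)⁻¹)) ∧
      ∃ e : (mGroup F ⋊[φ] MulAut (BurnLoop F)) ≃* collineationGroup (BurnLoop F),
        (∀ f : mGroup F, (e (SemidirectProduct.inl f) : Equiv.Perm (BurnLoop F × BurnLoop F)) =
          f) ∧
        (∀ σ : MulAut (BurnLoop F),
          (e (SemidirectProduct.inr σ) : Equiv.Perm (BurnLoop F × BurnLoop F)) =
            pairHom (BurnLoop F) (MulAut.toPerm _ σ, MulAut.toPerm _ σ)) := by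
  have hM : mPairs F ≤ autotopismPairs (BurnLoop F) := fun f hf => (mem_mPairs.1 hf).1
  have hnormal : ∀ f ∈ autotopismPairs (BurnLoop F), ∀ m ∈ mPairs F, f * m * f⁻¹ ∈ mPairs F :=
    fun f hf m hm => mPairs_normal hn hf hm
  have htrans : ∀ f ∈ autotopismPairs (BurnLoop F),
      ∃ m ∈ mPairs F, m.1 1 = f.1 1 ∧ m.2 1 = f.2 1 := fun f hf => mPairs_transitive hn hf
  have hfree : ∀ m ∈ mPairs F, m.1 1 = 1 → m.2 1 = 1 → m = 1 := fun m hm => mPairs_free hm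
  refine ⟨lambdaZero_le_leftMultGroup, (mPairs_eq_and_mul_eq F).2,
    map_pairHom_le_collineationGroup hM, ⟨fun m hm f => ?_⟩, ?_, nonempty_mGroup_mulEquiv hn,
    fun P hP Q hQ => regular_on_orbit htrans hfree hP hQ,
    exists_semidirectProduct hM hnormal htrans hfree⟩
  · exact conj_mem_map_pairHom hnormal f.2 hm
  · rintro _ ⟨f, hf, rfl⟩ _ ⟨g, hg, rfl⟩
    rw [← map_mul, ← map_mul, mPairs_mul_comm hn hf hg]
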